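/- **Setting.** Let $n\ge 1$, $\mathcal H=\mathbb R^{d_\xi}\times\mathbb R^{d_\zeta}$ with the Euclidean norm, $r_\xi,r_\zeta>0$, and let $f_1,\dots,f_n:\mathcal H\to\mathbb R$ be convex in $\xi$ for fixed $\zeta$ and concave in $\zeta$ for fixed $\xi$. Put $$p(\xi,\zeta)=\frac1n\sum_{i=1}^n f_i(\xi,\zeta)+\frac{r_\xi}{2}\|\xi\|^2-\frac{r_\zeta}{2}\|\zeta\|^2,\qquad \mathbf T_i(x)=\partial_\xi f_i(\xi,\zeta)\times\bigl(-\partial_\zeta f_i(\xi,\zeta)\bigr)\quad(x=(\xi,\zeta)),$$ and assume that $\|g\|\le M$ for all $i$, all $x$ and all $g\in\mathbf T_i(x)$. Let $x^*=(\xi^*,\zeta^*)$ be a solution (saddle point) of $\min_\xi\max_\zeta p$, and $G_{\mathrm{SPP}}(x_o)=p(\xi_o,\zeta^*)-p(\xi^*,\zeta_o)$ for $x_o=(\xi_o,\zeta_o)$. *Network.* Let $\mathbf W(\tau)\in\mathbb R^{n\times n}$, $\tau\ge0$, be gossip matrices of a time-varying graph on $\{1,\dots,n\}$ with edge sets $\mathcal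 E(\tau)$: $\mathbf W(\tau)_{ij}=0$ if $i\ne j$ and $(j,i)\notin\mathcal E(\tau)$, and $\mathbf W(\tau)\mathbf 1=0=\mathbf W(\tau)^\top\mathbf 1$. Let $\chi\ge1$ satisfy $\|\mathbf W(\tau)v-v\|^2\le(1-\frac1\chi)\|v\|^2$ for all $\tau\ge 0$ and all $v\in\mathbb R^n$ with $\sum_iv_i=0$. *Oracle.* A call of node $i$ at $x$ returns a random vector $\tilde{\mathbf g}_i(x)$, a jointly measurable function of $x$ and of a random sample with a fixed law, such that $\mathbb E\,\tilde{\mathbf g}_i(x)=\mathbf g_i(x)\in\mathbf T_i(x)$ and $\mathbb E\|\tilde{\mathbf g}_i(x)-\mathbf g_i(x)\|^2\le\sigma^2$, where $\sigma\ge0$. The samples used at different steps $(k,t)$ are independent; no independence between the nodes is required. *Algorithm 1*, for regularization constant $r>0$, with $K\ge1$ outer and $T\ge1$ inner iterations, acts on $n$-tuples of elements of $\mathcal H$ (one for each node). Start from $x^0=x^{-1}=\tilde x^0=\bar x^0=0$, $y^0=\bar y^0=0$, $z^0=\bar z^0=0$, $m^0=0$. For $k=0,\dots,K-1$, with $\mathbf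 W_k=\mathbf W(\tau_k)$ for arbitrary times $\tau_k\ge0$, acting on the node index, compute $$\underline y^k=\alpha_ky^k+(1-\alpha_k)\bar y^k,\quad \underline z^k=\alpha_kz^k+(1-\alpha_k)\bar z^k,\quad g^k=r_{yz}(\underline y^k+\underline z^k),\quad \tilde g^k=\mathbf W_kg^k,\quad \hat g^k=\mathbf W_k(g^k+m^k),$$ $$\hat x^{k+1}=x^k+\gamma_k(\tilde x^k-x^{k-1}),\quad y^{k+1}=y^k-\eta_y^k(g^k+\hat x^{k+1}),\quad z^{k+1}=z^k-\eta_z^k\hat g^k,$$ $$\bar y^{k+1}=\underline y^k+\alpha_k(y^{k+1}-y^k),\quad \bar z^{k+1}=\underline z^k-\theta_z\tilde g^k,\quad m^{k+1}=\tfrac{\eta_z^k}{\eta_z^{k+1}}(m^k+g^k-\hat g^k);$$ then put $x^{k,0}=x^k$ and, for $t=0,\dots,T-1$, let $g_x^{k,t}=(\tilde{\mathbf g}_i(x_i^{k,t}))_{i=1}^n$ and let $x^{k,t+1}$ be the solution of $$x^{k,t+1}=x^{k,t}-\eta_x^k\bigl(g_x^{k,t}+\beta x^{k,t+1}-y^{k+1}+\tau_x^k(x^{k,t+1}-x^k)\bigr);$$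 finally put $$\tilde x^{k+1}=\tfrac1T\sum_{t=1}^Tx^{k,t},\quad x^{k+1}=\sigma_kx^{k,T}+(1-\sigma_k)\tilde x^{k+1},\quad \bar x^{k+1}=\alpha_k\tilde x^{k+1}+(1-\alpha_k)\bar x^k.$$ The output is $x_o^K=\frac1n\sum_i x^K_{a,i}$, where $x_a^K=\bigl(\sum_{k=1}^K\lambda_k\bigr)^{-1}\sum_{k=1}^K\lambda_k\bar x^k$. The parameters are $r_x=\beta=\frac23r$, $r_{yz}=\frac3r$, $\alpha_k=\frac3{k+3}$, $\gamma_k=\frac{k+2}{k+3}$, $\tau_x^k=\frac{r_x}{2\alpha_k}$, $\eta_x^k=\frac1{\tau_x^kT}$, $\eta_y^k=\frac1{4r_{yz}\alpha_k}$, $\eta_z^k=\frac1{10r_{yz}\chi^2\alpha_k}$, $\theta_z=\frac1{2r_{yz}}$, $\sigma_k=\frac{\tau_x^k}{2\tau_x^k+\beta}$, $\lambda_k=\alpha_{k-1}^{-2}+\alpha_k^{-1}-\alpha_k^{-2}$ for $1\le k<K$, and $\lambda_K=\alpha_{K-1}^{-2}$. Such a run uses $K$ decentralized communication rounds and $K\cdot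 T$ oracle calls (at each node). For the problem with constants $r_\xi,r_\zeta$, Algorithm 1 is run with $r=1$ in the variables $(\sqrt{r_\xi}\,\xi,\sqrt{r_\zeta}\,\zeta)$, that is, on the functions $f_i(\xi/\sqrt{r_\xi},\zeta/\sqrt{r_\zeta})$ with the correspondingly rescaled oracle, and $x_o^K$ denotes its output expressed in the original variables. **Statement.** There is an absolute constant $C>0$ such that, for all data as above and every $\varepsilon>0$, with $$a=\frac{\chi M}{\sqrt\varepsilon}\sqrt{\frac1{r_\xi}+\frac1{r_\zeta}},\qquad b=\frac{(M+\sigma)^2}{\varepsilon}\Bigl(\frac1{r_\xi}+\frac1{r_\zeta}\Bigr),$$ the following holds. 1. For all integers $K,T\ge1$: if the number $K$ of communication rounds is at least $Ca$ and the number $KT$ of oracle calls is at least $Cb$, then $G_{\mathrm{SPP}}(x_o^K)$ is integrable and $\mathbb E[G_{\mathrm{SPP}}(x_o^K)]\le\varepsilon$. 2. There are $K,T\ge1$ for which $G_{\mathrm{SPP}}(x_o^K)$ is integrable, $\mathbb E[G_{\mathrm{SPP}}(x_o^K)]\le\varepsilon$, $K\le Ca+1$ and $KT\le C\max(a,b)+1$.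 In particular $KT\le Cb+1$ whenever $a\le b$, which is the case for all sufficiently small $\varepsilon$ when the other data are fixed. So $\mathcal O(a)$ decentralized communications and $\mathcal O(b)$ oracle calls suffice for $\mathbb E[G_{\mathrm{SPP}}(x_o^K)]\le\varepsilon$. -/

import Mathlib

open MeasureTheory ProbabilityTheory Set
open scoped NNReal Matrix

noncomputable section

/-! ### The saddle-point problem -/

/-- The solution space `ℝ^{dξ} × ℝ^{dζ}` with the Euclidean norm of `ℝ^{dξ + dζ}`;
a point is `x = (x.fst, x.snd) = (ξ, ζ)`. -/
abbrev SPSpace (dξ dζ : ℕ) : Type :=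
  WithLp 2 (EuclideanSpace ℝ (Fin dξ) × EuclideanSpace ℝ (Fin dζ))

/-- A function of `(ξ, ζ)`. -/
abbrev SPFun (dξ dζ : ℕ) : Type :=
  EuclideanSpace ℝ (Fin dξ) → EuclideanSpace ℝ (Fin dζ) → ℝ

/-- The objective
`p(ξ, ζ) = (1/n) ∑ i, f i (ξ, ζ) + (rξ/2) ‖ξ‖² - (rζ/2) ‖ζ‖²`. -/
def asymObjective {n dξ dζ : ℕ} (f : Fin n → SPFun dξ dζ) (rξ rζ : ℝ) : SPFun dξ dζ :=
  fun ξ ζ => (1 / (n : ℝ)) * ∑ i, f i ξ ζ + rξ / 2 * ‖ξ‖ ^ 2 - rζ / 2 * ‖ζ‖ ^ 2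

/-- `f` is convex in `ξ` for each fixed `ζ`, and concave in `ζ` for each fixed `ξ`. -/
def ConvexConcave {dξ dζ : ℕ} (f : SPFun dξ dζ) : Prop :=
  (∀ ζ, ConvexOn ℝ univ (fun ξ => f ξ ζ)) ∧ (∀ ξ, ConcaveOn ℝ univ (fun ζ => f ξ ζ))

/-- The set-valued operator `T(x) = [∂_ξ f(ξ, ζ), -∂_ζ f(ξ, ζ)]` at `x = (ξ, ζ)`:
the subdifferential of the convex function `f(·, ζ)` at `ξ`, times minus the superdifferential
of the concave function `f(ξ, ·)` at `ζ`. -/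
def saddleOperator {dξ dζ : ℕ} (f : SPFun dξ dζ) (x : SPSpace dξ dζ) : Set (SPSpace dξ dζ) :=
  {g | (∀ ξ', f x.fst x.snd + inner ℝ g.fst (ξ' - x.fst) ≤ f ξ' x.snd) ∧
       (∀ ζ', f x.fst ζ' ≤ f x.fst x.snd + inner ℝ (-g.snd) (ζ' - x.snd))}

/-- `xs = (ξ*, ζ*)` solves `min_ξ max_ζ p(ξ, ζ)`, i.e. it is a saddle point of `p`. -/
def IsSolution {dξ dζ : ℕ} (p : SPFun dξ dζ) (xs : SPSpace dξ dζ) : Prop :=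
  IsSaddlePointOn univ univ p xs.fst xs.snd

/-- The gap `G_SPP(x_o) = p(ξ_o, ζ*) - p(ξ*, ζ_o)`. -/
def gapSPP {dξ dζ : ℕ} (p : SPFun dξ dζ) (xs xo : SPSpace dξ dζ) : ℝ :=
  p xo.fst xs.snd - p xs.fst xo.snd

/-! ### The time-varying network -/

/-- `W(τ)` is a gossip matrix for the graph with edge set `edges τ`, for every time `τ ≥ 0`. -/
structure IsGossip {n : ℕ} (edges : ℝ≥0 → Set (Fin n × Fin n))
    (W : ℝ≥0 → Matrix (Fin n) (Fin n) ℝ) : Prop where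
  support : ∀ τ i j, i ≠ j → (j, i) ∉ edges τ → W τ i j = 0
  mulVec_one : ∀ τ, W τ *ᵥ 1 = 0
  transpose_mulVec_one : ∀ τ, (W τ)ᵀ *ᵥ 1 = 0

/-- `χ ≥ 1` bounds the condition number of the network:
`‖W(τ) x - x‖² ≤ (1 - 1/χ) ‖x‖²` (Euclidean norms) whenever `∑ i, x i = 0`. -/
def HasConditionNumber {n : ℕ} (W : ℝ≥0 → Matrix (Fin n) (Fin n) ℝ) (χ : ℝ) : Prop :=
  1 ≤ χ ∧ ∀ τ, ∀ x : Fin n → ℝ, ∑ i, x i = 0 →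
    ∑ i, ((W τ *ᵥ x) i - x i) ^ 2 ≤ (1 - 1 / χ) * ∑ i, x i ^ 2

/-! ### The stochastic oracle -/

/-- Stochastic oracle for the operators `T i`, one for each node: at the point `x` and for the
random sample `s` of law `D`, node `i` receives the vector `gt i s x`. Its mean lies in `T i x`
and its variance is at most `σ²`. (The sample `s` is common notation for the randomness of all the
nodes, so their answers may or may not be independent of each other.) -/
structure IsStochasticOracle {n dξ dζ : ℕ} {S : Type*} [MeasurableSpace S] (D : Measure S)
    (T : Fin n → SPSpace dξ dζ → Set (SPSpace dξ dζ)) (σ : ℝ)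
    (gt : Fin n → S → SPSpace dξ dζ → SPSpace dξ dζ) : Prop where
  measurable : ∀ i, Measurable (fun q : S × SPSpace dξ dζ => gt i q.1 q.2)
  memLp : ∀ i x, MemLp (fun s => gt i s x) 2 D
  mean_mem : ∀ i x, ∫ s, gt i s x ∂D ∈ T i x
  variance_le : ∀ i x, ∫ s, ‖gt i s x - ∫ s', gt i s' x ∂D‖ ^ 2 ∂D ≤ σ ^ 2

/-! ### The decentralized algorithm -/

/-- The scalar parameters of the algorithm, indexed by the outer iteration `k`; `ryz` is the
constant in `G(y, z) = (ryz/2) ‖y + z‖²`. -/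
structure AlgParams where
  α : ℕ → ℝ
  β : ℕ → ℝ
  γ : ℕ → ℝ
  σ : ℕ → ℝ
  lam : ℕ → ℝ
  τx : ℕ → ℝ
  ηx : ℕ → ℝ
  ηy : ℕ → ℝ
  ηz : ℕ → ℝ
  θz : ℕ → ℝ
  ryz : ℝ

/-- The variables before outer iteration `k`: `x^k`, `x^{k-1}`, `x̃^k`, `x̄^k`, `y^k`, `ȳ^k`,
`z^k`, `z̄^k`, `m^k`. Each is an `n`-tuple, one entry for each node. -/
structure AlgState (n : ℕ) (V : Type*) where
  x : Fin n → V
  xPrev : Fin n → V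
  xTilde : Fin n → V
  xBar : Fin n → V
  y : Fin n → V
  yBar : Fin n → V
  z : Fin n → V
  zBar : Fin n → V
  m : Fin n → V

section Algorithm

variable {n : ℕ} {V : Type*} [AddCommGroup V] [Module ℝ V]

/-- `(W ⊗ I) v`: every node forms the weighted sum of the vectors of its neighbours. -/
def gossip (W : Matrix (Fin n) (Fin n) ℝ) (v : Fin n → V) : Fin n → V :=
  fun i => ∑ j, W i j • v j

/-- The implicit inner update, solved for the new point; see `innerUpdate_spec`. -/
def innerUpdate (ηx β τx : ℝ) (xk yNext g x : Fin n → V) : Fin n → V :=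
  (1 + ηx * (β + τx))⁻¹ • (x - ηx • (g - yNext - τx • xk))

/-- `innerUpdate` is the solution `x'` of `x' = x - ηx (g + β x' - y^{k+1} + τx (x' - x^k))`. -/
theorem innerUpdate_spec (ηx β τx : ℝ) (h : 1 + ηx * (β + τx) ≠ 0)
    (xk yNext g x : Fin n → V) :
    innerUpdate ηx β τx xk yNext g x =
      x - ηx • (g + β • innerUpdate ηx β τx xk yNext g x - yNext
        + τx • (innerUpdate ηx β τx xk yNext g x - xk)) := by
  have key : (1 + ηx * (β + τx)) • innerUpdate ηx β τx xk yNext g x =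
      x - ηx • (g - yNext - τx • xk) := by
    rw [innerUpdate, smul_inv_smul₀ h]
  generalize innerUpdate ηx β τx xk yNext g x = w at key ⊢
  have h2 : w = (1 + ηx * (β + τx)) • w - (ηx * (β + τx)) • w := by module
  rw [key] at h2
  refine h2.trans ?_
  module

/-- The inner iterates `x^{k,0} = x^k`, `x^{k,1}`, `x^{k,2}`, …; at step `t` node `i` makes one
oracle call, with answer `g t i (x_i^{k,t})`. -/
def innerIter (ηx β τx : ℝ) (g : ℕ → Fin n → V → V) (xk yNext : Fin n → V) : ℕ → Fin n → V
  | 0 => xk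
  | t + 1 => innerUpdate ηx β τx xk yNext
      (fun i => g t i (innerIter ηx β τx g xk yNext t i)) (innerIter ηx β τx g xk yNext t)

/-- Outer iteration `k`: one communication round, in which the nodes multiply by the gossip
matrix `W`, followed by `T` oracle calls at each node. -/
def outerStep (P : AlgParams) (T k : ℕ) (W : Matrix (Fin n) (Fin n) ℝ)
    (g : ℕ → Fin n → V → V) (s : AlgState n V) : AlgState n V :=
  let yU := P.α k • s.y + (1 - P.α k) • s.yBar
  let zU := P.α k • s.z + (1 - P.α k) • s.zBar
  -- the two partial gradients of `G` at `(yU, zU)`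
  let gy := P.ryz • (yU + zU)
  let gz := P.ryz • (yU + zU)
  let gzTilde := gossip W gz
  let gzHat := gossip W (gz + s.m)
  let xHat := s.x + P.γ k • (s.xTilde - s.xPrev)
  let yNext := s.y - P.ηy k • (gy + xHat)
  let zNext := s.z - P.ηz k • gzHat
  let xIn := innerIter (P.ηx k) (P.β k) (P.τx k) g s.x yNext
  let xTildeNext := (1 / (T : ℝ)) • ∑ t ∈ Finset.Icc 1 T, xIn t
  { x := P.σ k • xIn T + (1 - P.σ k) • xTildeNext
    xPrev := s.x
    xTilde := xTildeNext
    xBar := P.α k • xTildeNext + (1 - P.α k) • s.xBar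
    y := yNext
    yBar := yU + P.α k • (yNext - s.y)
    z := zNext
    zBar := zU - P.θz k • gzTilde
    m := (P.ηz k / P.ηz (k + 1)) • (s.m + gz - gzHat) }

/-- The state before outer iteration `k`, started from `x⁰ = x⁻¹ = x̃⁰ = x̄⁰`, `y⁰ = ȳ⁰`,
`z⁰ = z̄⁰` and `m⁰`. `W k` is the gossip matrix of round `k`, and `g k t i` is the answer of the
oracle to node `i` at step `t` of outer iteration `k`. -/
def algState (P : AlgParams) (T : ℕ) (x0 y0 z0 m0 : Fin n → V)
    (W : ℕ → Matrix (Fin n) (Fin n) ℝ) (g : ℕ → ℕ → Fin n → V → V) : ℕ → AlgState n V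
  | 0 => ⟨x0, x0, x0, x0, y0, y0, z0, z0, m0⟩
  | k + 1 => outerStep P T k (W k) (g k) (algState P T x0 y0 z0 m0 W g k)

/-- The output after `K` outer iterations: the `lam`-weighted mean of `x̄^1, …, x̄^K`, averaged
over the nodes. -/
def algOutput (P : AlgParams) (K T : ℕ) (x0 y0 z0 m0 : Fin n → V)
    (W : ℕ → Matrix (Fin n) (Fin n) ℝ) (g : ℕ → ℕ → Fin n → V → V) : V :=
  let xa : Fin n → V := (∑ k ∈ Finset.Icc 1 K, P.lam k)⁻¹ •
    ∑ k ∈ Finset.Icc 1 K, P.lam k • (algState P T x0 y0 z0 m0 W g k).xBar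
  (1 / (n : ℝ)) • ∑ i, xa i

end Algorithm

/-- The number of communication rounds of a run with `K` outer iterations. -/
def communicationRounds (K : ℕ) : ℕ := K

/-- The number of oracle calls (at each node) of a run with `K` outer iterations of `T` inner
steps each. -/
def oracleCalls (K T : ℕ) : ℕ := K * T

/-- The parameters for a problem with symmetric regularization constant `r` on a network of
condition number `χ`, for a run with `K` outer and `T` inner iterations. -/
def stdParams (r χ : ℝ) (K T : ℕ) : AlgParams :=
  let α : ℕ → ℝ := fun k => 3 / ((k : ℝ) + 3)
  let rx : ℝ := 2 / 3 * r
  let ryz : ℝ := 3 / r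
  let τx : ℕ → ℝ := fun k => (rx / 2) / α k
  { α := α
    β := fun _ => rx
    γ := fun k => ((k : ℝ) + 2) / ((k : ℝ) + 3)
    σ := fun k => τx k / (2 * τx k + rx)
    lam := fun k => if k = K then (α (k - 1) ^ 2)⁻¹
      else (α (k - 1) ^ 2)⁻¹ + (α k)⁻¹ - (α k ^ 2)⁻¹
    τx := τx
    ηx := fun k => 1 / (τx k * T)
    ηy := fun k => (1 / (4 * ryz)) / α k
    ηz := fun k => (1 / (10 * ryz * χ ^ 2)) / α k
    θz := fun _ => 1 / (2 * ryz)
    ryz := ryz }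

/-! ### The asymmetric problem -/

/-- The change of variables `(ξ, ζ) ↦ (ξ / √rξ, ζ / √rζ)`. -/
def rescale {dξ dζ : ℕ} (rξ rζ : ℝ) (x : SPSpace dξ dζ) : SPSpace dξ dζ :=
  WithLp.toLp 2 ((Real.sqrt rξ)⁻¹ • x.fst, (Real.sqrt rζ)⁻¹ • x.snd)

/-- The algorithm for the problem with constants `rξ`, `rζ`. In the variables
`(√rξ ξ, √rζ ζ)` the problem has the symmetric constant `1` and the functions
`f i (ξ / √rξ, ζ / √rζ)`, whose stochastic oracle is `rescale ∘ g ∘ rescale`; the algorithm is run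
on it from the origin, and its output is returned in the original variables. -/
def asymOutput {n dξ dζ : ℕ} (rξ rζ χ : ℝ) (K T : ℕ) (W : ℕ → Matrix (Fin n) (Fin n) ℝ)
    (g : ℕ → ℕ → Fin n → SPSpace dξ dζ → SPSpace dξ dζ) : SPSpace dξ dζ :=
  rescale rξ rζ (algOutput (stdParams 1 χ K T) K T 0 0 0 0 W
    (fun k t i x => rescale rξ rζ (g k t i (rescale rξ rζ x))))

end

/-! ### Proximal stochastic subgradient steps: the inner loop -/

section InnerProduct

variable {E : Type*} [NormedAddCommGroup E] [InnerProductSpace ℝ E]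

/-! After rescaling to the symmetric constant 1, the gap at x equals (1/n) ∑ q_i(x) + ‖x‖²/2 -
‖x*‖²/2, where q_i(ξ, ζ) = f_i(ξ, ζ*) - f_i(ξ*, ζ) (`gapSPP_rescale`). The q_i are convex, Lipschitz
and vanish at x*, and every g in the saddle operator satisfies q_i(x) ≤ ⟪g, x - x*⟫. This one
inequality, with comparison point x*, is all that a subgradient method needs (`nodeProblem_gapFun`).
So the analysis is that of a decentralized strongly convex minimization, although the algorithm
never sees the q_i.

Consensus is imposed by duality. Split ‖x‖²/2 = ‖x‖²/3 + ‖x‖²/6; the maximum over y of -⟪y, x⟫ -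
(3/2)‖y + z‖² is ‖x‖²/6 + ⟪z, x⟫, so the second part is dualized and z, of sum zero, is the
multiplier of consensus. Communication enters only through the smooth quadratic in (y, z). It is
treated by an accelerated method in which gossip replaces the projection onto sum-zero tuples, and
error feedback corrects the inexactness of the z-updates (`dual_step`). The nonsmooth part enters
only through the inner loop, T averaged proximal subgradient steps (`prox_subgradient_average`).
Extrapolation of x couples the two, and one potential decreases up to oracle error
(`primal_dual_step`).

Weighted summation (`sum_lam_lagrangianGap_le`) bounds the Lagrangian gaps by the initial potential,
with total weight at least K²/9. Dual comparison points chosen in terms of the output turn this into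
a bound of the true gap, valid on every sample path (`exists_dual_comparison`, `gap_algOutput_le`).
These points never meet the oracle noise, which is paired only with x* - u for a point u determined
by earlier samples. Hence the noise terms have mean zero and the expected gap is at most of order
χ²L²/K² + (L + σ)²/(KT) (`integral_gap_algOutput_le`). The two terms dictate the number of rounds
and of oracle calls. -/

theorem convexOn_norm_sub_sq (a : E) : ConvexOn ℝ univ (fun x : E => ‖x - a‖ ^ 2) := by
  refine ⟨convex_univ, fun x _ y _ s t hs ht hst => ?_⟩
  have h : s • x + t • y - a = s • (x - a) + t • (y - a) := by
    have : a = (s + t) • a := by rw [hst, one_smul]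
    nth_rw 1 [this]
    module
  have hs1 : s = 1 - t := by linarith
  have h2 : ‖s • (x - a) + t • (y - a)‖ ^ 2
      = s * ‖x - a‖ ^ 2 + t * ‖y - a‖ ^ 2 - s * t * ‖(x - a) - (y - a)‖ ^ 2 := by
    generalize x - a = u
    generalize y - a = v
    simp only [← real_inner_self_eq_norm_sq, inner_add_left, inner_sub_left, inner_add_right,
      inner_sub_right, real_inner_smul_right, real_inner_comm]
    rw [hs1]
    ring
  simp only [smul_eq_mul]
  rw [h, h2]
  have := mul_nonneg (mul_nonneg hs ht) (sq_nonneg ‖(x - a) - (y - a)‖)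
  linarith

/-- One step of the proximal stochastic subgradient method. -/
theorem prox_subgradient_step {q : E → ℝ} {L η β τ : ℝ} (hη : 0 ≤ η) {xs a y u u' g gm : E}
    (hq : q u' - q u ≤ L * ‖u' - u‖) (hgm : q u ≤ inner ℝ gm (u - xs)) (hL : ‖gm‖ ≤ L)
    (hu' : u' = u - η • (g + β • u' - y + τ • (u' - a))) :
    η * (q u' + β / 2 * ‖u'‖ ^ 2 - β / 2 * ‖xs‖ ^ 2 - inner ℝ y (u' - xs) + τ / 2 * ‖u' - a‖ ^ 2
        - τ / 2 * ‖a - xs‖ ^ 2 + (β + τ) / 2 * ‖u' - xs‖ ^ 2)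
      + ‖u' - xs‖ ^ 2 / 2 - ‖u - xs‖ ^ 2 / 2
      ≤ η * (inner ℝ (g - gm) (xs - u) + η / 2 * (2 * L + ‖g - gm‖) ^ 2) := by
  have hd : u' - u = -(η • (g + β • u' - y + τ • (u' - a))) := by
    nth_rw 1 [hu']; abel
  have h0 : inner ℝ (u' - u) (u' - xs)
      = -(η * inner ℝ (g + β • u' - y + τ • (u' - a)) (u' - xs)) := by
    rw [hd, inner_neg_left, real_inner_smul_left]
  have h1 : inner ℝ (u' - u) (u' - xs)
      = ‖u' - xs‖ ^ 2 / 2 + ‖u' - u‖ ^ 2 / 2 - ‖u - xs‖ ^ 2 / 2 := by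
    simp only [← real_inner_self_eq_norm_sq, inner_sub_left, inner_sub_right, real_inner_comm]
    ring
  have h2 : inner ℝ (g + β • u' - y + τ • (u' - a)) (u' - xs)
      = inner ℝ gm (u - xs) + inner ℝ gm (u' - u) + inner ℝ (g - gm) (u' - u)
        - inner ℝ (g - gm) (xs - u)
        + β / 2 * (‖u'‖ ^ 2 - ‖xs‖ ^ 2 + ‖u' - xs‖ ^ 2) - inner ℝ y (u' - xs)
        + τ / 2 * (‖u' - a‖ ^ 2 - ‖a - xs‖ ^ 2 + ‖u' - xs‖ ^ 2) := by
    simp only [← real_inner_self_eq_norm_sq, inner_add_left, inner_sub_left, inner_sub_right,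
      real_inner_smul_right, real_inner_comm]
    ring
  have h3 : -(L * ‖u' - u‖) ≤ inner ℝ gm (u' - u) :=
    (neg_le_neg (mul_le_mul_of_nonneg_right hL (norm_nonneg _))).trans
      (neg_le_of_abs_le (abs_real_inner_le_norm gm (u' - u)))
  have h4 : -(‖g - gm‖ * ‖u' - u‖) ≤ inner ℝ (g - gm) (u' - u) :=
    neg_le_of_abs_le (abs_real_inner_le_norm (g - gm) (u' - u))
  -- One L pays for moving q from u to u', the other for the subgradient at u; without smoothness
  -- neither is of second order.
  have h5 : q u' - (2 * L + ‖g - gm‖) * ‖u' - u‖ ≤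
      inner ℝ gm (u - xs) + inner ℝ gm (u' - u) + inner ℝ (g - gm) (u' - u) := by linarith
  have h6 := mul_le_mul_of_nonneg_left h5 hη
  -- The term -‖u' - u‖²/2 of the three-point identity absorbs the linear term by completing the
  -- square.
  have h7 := sq_nonneg (‖u' - u‖ - η * (2 * L + ‖g - gm‖))
  rw [h1, h2] at h0
  nlinarith

/-- The inner loop: `T` steps from `a`, averaged. -/
theorem prox_subgradient_average {q : E → ℝ} (hqc : ConvexOn ℝ univ q) {L η β τ s : ℝ}
    {T : ℕ} (hT : 1 ≤ T) (hβ : 0 ≤ β) (hτ : 0 < τ) (hη : η = 1 / (τ * T))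
    (hs : s = τ / (2 * τ + β))
    (hq : ∀ u u', q u' - q u ≤ L * ‖u' - u‖) {xs a y : E} {u g gm : ℕ → E} (hu0 : u 0 = a)
    (hgm : ∀ t, q (u t) ≤ inner ℝ (gm t) (u t - xs)) (hL : ∀ t, ‖gm t‖ ≤ L)
    (hu : ∀ t, u (t + 1) = u t - η • (g t + β • u (t + 1) - y + τ • (u (t + 1) - a)))
    {xt x' : E} (hxt : xt = (1 / (T : ℝ)) • ∑ t ∈ Finset.Icc 1 T, u t)
    (hx' : x' = s • u T + (1 - s) • xt) :
    q xt + β / 2 * ‖xt‖ ^ 2 - β / 2 * ‖xs‖ ^ 2 - inner ℝ y (xt - xs) + τ / 2 * ‖xt - a‖ ^ 2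
        + (τ + β / 2) * ‖x' - xs‖ ^ 2
      ≤ τ * ‖a - xs‖ ^ 2 + (1 / (T : ℝ)) * ∑ t ∈ Finset.range T,
          (inner ℝ (g t - gm t) (xs - u t) + η / 2 * (2 * L + ‖g t - gm t‖) ^ 2) := by
  have hT0 : (0 : ℝ) < T := by exact_mod_cast hT
  have hη0 : 0 < η := by rw [hη]; positivity
  have hητ : η * (τ * T) = 1 := by rw [hη]; field_simp
  set Φ : E → ℝ := fun w => q w + β / 2 * ‖w‖ ^ 2 - inner ℝ y w
    + τ / 2 * ‖w - a‖ ^ 2 + (β + τ) / 2 * ‖w - xs‖ ^ 2 with hΦ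
  have hlin : ConvexOn ℝ univ (fun w : E => -inner ℝ y w) :=
    ((-(innerₛₗ ℝ y)).convexOn convex_univ)
  have hsq : ConvexOn ℝ univ (fun w : E => ‖w‖ ^ 2) := by
    simpa using convexOn_norm_sub_sq (0 : E)
  have hΦc : ConvexOn ℝ univ Φ := by
    have := (((hqc.add (hsq.smul (show 0 ≤ β / 2 by positivity))).add hlin).add
      ((convexOn_norm_sub_sq a).smul (show 0 ≤ τ / 2 by positivity))).add
      ((convexOn_norm_sub_sq xs).smul (show 0 ≤ (β + τ) / 2 by positivity))
    refine this.congr fun w _ => ?_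
    simp only [hΦ, Pi.add_apply, smul_eq_mul]
    ring
  have hI : ∀ F : ℕ → ℝ, ∑ t ∈ Finset.Icc 1 T, F t = ∑ t ∈ Finset.range T, F (t + 1) := by
    intro F
    rw [Finset.range_eq_Ico, Finset.sum_Ico_add' F 0 T 1]
    rfl
  have hJ : Φ xt ≤ (1 / (T : ℝ)) * ∑ t ∈ Finset.range T, Φ (u (t + 1)) := by
    have := hΦc.map_sum_le (t := Finset.Icc 1 T) (w := fun _ => 1 / (T : ℝ)) (p := u)
      (fun _ _ => by positivity) (by simp [hT0.ne']) (fun _ _ => mem_univ _)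
    rw [← Finset.smul_sum, ← hxt] at this
    refine this.trans_eq ?_
    simp only [smul_eq_mul, ← Finset.mul_sum, hI]
  have hstep : ∀ t, η * (Φ (u (t + 1)) - β / 2 * ‖xs‖ ^ 2 + inner ℝ y xs - τ / 2 * ‖a - xs‖ ^ 2)
      + (‖u (t + 1) - xs‖ ^ 2 / 2 - ‖u t - xs‖ ^ 2 / 2)
      ≤ η * (inner ℝ (g t - gm t) (xs - u t) + η / 2 * (2 * L + ‖g t - gm t‖) ^ 2) := by
    intro t
    have := prox_subgradient_step hη0.le (hq (u t) (u (t + 1))) (hgm t) (hL t) (hu t)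
    rw [inner_sub_right] at this
    refine le_trans (le_of_eq ?_) this
    simp only [hΦ]
    ring
  have hsum := Finset.sum_le_sum fun t (_ : t ∈ Finset.range T) => hstep t
  rw [Finset.sum_add_distrib, Finset.sum_range_sub (fun t => ‖u t - xs‖ ^ 2 / 2),
    ← Finset.mul_sum, ← Finset.mul_sum, hu0] at hsum
  simp only [Finset.sum_sub_distrib, Finset.sum_add_distrib, Finset.sum_const,
    Finset.card_range, nsmul_eq_mul] at hsum ⊢
  rw [← Finset.sum_add_distrib] at hsum ⊢
  set S1 := ∑ t ∈ Finset.range T, Φ (u (t + 1))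
  set S2 := ∑ t ∈ Finset.range T,
    (inner ℝ (g t - gm t) (xs - u t) + η / 2 * (2 * L + ‖g t - gm t‖) ^ 2)
  have hkey := mul_le_mul_of_nonneg_left hsum hτ.le
  -- The step size gives τη = 1/T, so the telescoped distances keep the weight τ/2 independently of
  -- T.
  have e1 : ∀ c : ℝ, τ * (η * c) = 1 / T * c := by
    intro c
    rw [hη]; field_simp
  -- The inner loop controls the distances from xs of both the last iterate and the average. The
  -- value of s is the one for which convexity merges the two weights into τ + β/2 at the single
  -- point x'.
  have hxn : (τ + β / 2) * ‖x' - xs‖ ^ 2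
      ≤ τ / 2 * ‖u T - xs‖ ^ 2 + (τ + β) / 2 * ‖xt - xs‖ ^ 2 := by
    have hden : 0 < 2 * τ + β := by positivity
    have h1s : 1 - s = (τ + β) / (2 * τ + β) := by
      rw [hs]; field_simp; ring
    have := (convexOn_norm_sub_sq xs).2 (mem_univ (u T)) (mem_univ xt)
      (show 0 ≤ s by rw [hs]; positivity) (show 0 ≤ 1 - s by rw [h1s]; positivity) (by ring)
    simp only [smul_eq_mul] at this
    rw [← hx'] at this
    have h2 := mul_le_mul_of_nonneg_left this (show 0 ≤ τ + β / 2 by positivity)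
    refine h2.trans_eq ?_
    rw [h1s, hs]
    field_simp
  have e2 := e1 S2
  have e3 : τ * (η * (S1 - T * (β / 2 * ‖xs‖ ^ 2) + T * inner ℝ y xs - T * (τ / 2 * ‖a - xs‖ ^ 2)))
      = 1 / T * S1 - β / 2 * ‖xs‖ ^ 2 + inner ℝ y xs - τ / 2 * ‖a - xs‖ ^ 2 := by
    rw [e1]; field_simp
  rw [mul_add, e2, e3] at hkey
  rw [inner_sub_right]
  simp only [hΦ] at hJ
  nlinarith

end InnerProduct

/-! ### Accelerated dual updates with gossip and error feedback -/

section InnerProduct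

variable {E : Type*} [NormedAddCommGroup E] [InnerProductSpace ℝ E]

/-- `P` is an orthogonal projection and `W` is a gossip operator on its range, with condition
number `χ`. -/
structure IsGossipOperator (P W : E →ₗ[ℝ] E) (χ : ℝ) : Prop where
  symm : ∀ v w, inner ℝ (P v) w = inner ℝ v (P w)
  idem : ∀ v, P (P v) = P v
  proj_comp : ∀ v, P (W v) = W v
  comp_proj : ∀ v, W (P v) = W v
  one_le : 1 ≤ χ
  contract : ∀ v, ‖W v - P v‖ ^ 2 ≤ (1 - 1 / χ) * ‖P v‖ ^ 2

namespace IsGossipOperator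

variable {P W : E →ₗ[ℝ] E} {χ : ℝ}

theorem inner_proj (h : IsGossipOperator P W χ) {v w : E} (hw : P w = w) :
    inner ℝ (P v) w = inner ℝ v w := by
  rw [h.symm, hw]

/-- Expand the square in the contraction property; since W g lies in the range of P, the projection
in the cross term can be dropped. This is what makes a gossip step decrease a smooth function like a
gradient step, up to the factor 1/χ. -/
theorem inner_gossip_sub (h : IsGossipOperator P W χ) (g : E) :
    ‖W g‖ ^ 2 - 2 * inner ℝ g (W g) ≤ -(1 / χ * ‖P g‖ ^ 2) := by
  have h1 : inner ℝ (P g) (W g) = inner ℝ g (W g) := h.inner_proj (h.proj_comp g)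
  have h2 := h.contract g
  rw [norm_sub_sq_real, real_inner_comm, h1] at h2
  linarith

/-- The accelerated descent step for `G(y, z) = (ρ/2) ‖y + z‖²`. -/
theorem descent (h : IsGossipOperator P W χ) {ρ α : ℝ} (hρ : 0 < ρ) (hα : 0 ≤ α) (hα1 : α ≤ 1)
    {y yb yU y' yb' yc z zb zU zb' zc g : E}
    (hyU : yU = α • y + (1 - α) • yb) (hzU : zU = α • z + (1 - α) • zb)
    (hg : g = ρ • (yU + zU)) (hyb : yb' = yU + α • (y' - y))
    (hzb : zb' = zU - (1 / (2 * ρ)) • W g) :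
    ρ / 2 * ‖yb' + zb'‖ ^ 2 ≤ (1 - α) * (ρ / 2 * ‖yb + zb‖ ^ 2) + α * (ρ / 2 * ‖yc + zc‖ ^ 2)
      + α * inner ℝ g (y' - yc) + α * inner ℝ g (z - zc) + ρ * α ^ 2 * ‖y' - y‖ ^ 2
      - 1 / (4 * ρ * χ) * ‖P g‖ ^ 2 := by
  have hW := h.inner_gossip_sub g
  have hχ := h.one_le
  have hquad : ∀ a b : E, ρ / 2 * ‖b‖ ^ 2 =
      ρ / 2 * ‖a‖ ^ 2 + inner ℝ (ρ • a) (b - a) + ρ / 2 * ‖b - a‖ ^ 2 := by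
    intro a b
    simp only [← real_inner_self_eq_norm_sq, inner_sub_left, inner_sub_right,
      real_inner_smul_right, real_inner_comm]
    ring
  have h1 : ρ / 2 * ‖yb' + zb'‖ ^ 2 = ρ / 2 * ‖yU + zU‖ ^ 2 + α * inner ℝ g (y' - y)
      - 1 / (2 * ρ) * inner ℝ g (W g) + ρ / 2 * ‖α • (y' - y) - (1 / (2 * ρ)) • W g‖ ^ 2 := by
    rw [hquad (yU + zU) (yb' + zb'), ← hg]
    have : yb' + zb' - (yU + zU) = α • (y' - y) - (1 / (2 * ρ)) • W g := by
      rw [hyb, hzb]; abel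
    rw [this, inner_sub_right, real_inner_smul_right, real_inner_smul_right]
    ring
  have h2 : ρ / 2 * ‖α • (y' - y) - (1 / (2 * ρ)) • W g‖ ^ 2
      ≤ ρ * α ^ 2 * ‖y' - y‖ ^ 2 + 1 / (4 * ρ) * ‖W g‖ ^ 2 := by
    have e := parallelogram_law_with_norm ℝ (α • (y' - y)) ((1 / (2 * ρ)) • W g)
    have n1 : ‖α • (y' - y)‖ ^ 2 = α ^ 2 * ‖y' - y‖ ^ 2 := by
      rw [norm_smul, mul_pow, Real.norm_eq_abs, sq_abs]
    have n2 : ‖(1 / (2 * ρ)) • W g‖ ^ 2 = (1 / (2 * ρ)) ^ 2 * ‖W g‖ ^ 2 := by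
      rw [norm_smul, mul_pow, Real.norm_eq_abs, sq_abs]
    have e2 : ‖α • (y' - y) - (1 / (2 * ρ)) • W g‖ ^ 2
        ≤ 2 * (α ^ 2 * ‖y' - y‖ ^ 2 + (1 / (2 * ρ)) ^ 2 * ‖W g‖ ^ 2) := by
      rw [← n1, ← n2]
      nlinarith [norm_nonneg (α • (y' - y) + (1 / (2 * ρ)) • W g)]
    refine (mul_le_mul_of_nonneg_left e2 (by positivity : 0 ≤ ρ / 2)).trans_eq ?_
    field_simp
    ring
  have h3 : ∀ b : E, ρ / 2 * ‖yU + zU‖ ^ 2 + inner ℝ g (b - (yU + zU)) ≤ ρ / 2 * ‖b‖ ^ 2 := by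
    intro b
    rw [hquad (yU + zU) b, ← hg]
    have : 0 ≤ ρ / 2 * ‖b - (yU + zU)‖ ^ 2 := by positivity
    linarith
  have h4 := mul_le_mul_of_nonneg_left (h3 (yb + zb)) (sub_nonneg.2 hα1)
  have h5 := mul_le_mul_of_nonneg_left (h3 (yc + zc)) hα
  have h6 : (1 - α) * inner ℝ g (yb + zb - (yU + zU)) + α * inner ℝ g (yc + zc - (yU + zU))
      = α * inner ℝ g (yc - y) + α * inner ℝ g (zc - z) := by
    rw [hyU, hzU]
    simp only [inner_add_right, inner_sub_right, real_inner_smul_right]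
    ring
  -- The step 1/(2ρ), half of the usual one, leaves room for the factor 2 lost in `h2`, where the y-
  -- and z-displacements are separated.
  have h7 : 1 / (4 * ρ) * ‖W g‖ ^ 2 - 1 / (2 * ρ) * inner ℝ g (W g)
      ≤ -(1 / (4 * ρ * χ) * ‖P g‖ ^ 2) := by
    have := mul_le_mul_of_nonneg_left hW (by positivity : 0 ≤ 1 / (4 * ρ))
    refine le_trans (le_of_eq ?_) (this.trans_eq ?_)
    · field_simp; ring
    · field_simp
  simp only [inner_sub_right] at *
  linarith

/-- The recursion for the compression error of the error feedback mechanism. -/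
theorem norm_error_sq_le (h : IsGossipOperator P W χ) {ηz ηz' : ℝ} (hη' : ηz' ≠ 0) {m m' g : E}
    (hm : m' = (ηz / ηz') • (m + g - W (g + m))) :
    ‖ηz' • P m'‖ ^ 2 ≤
      (1 - 1 / (2 * χ)) * ‖ηz • P m‖ ^ 2 + 2 * χ * (ηz ^ 2 * ‖P g‖ ^ 2) := by
  have hχ := h.one_le
  have hχ0 : 0 < χ := by linarith
  have e1 : ηz' • P m' = -(ηz • (W (g + m) - P (g + m))) := by
    rw [hm, map_smul, smul_smul, mul_div_cancel₀ _ hη', map_sub, h.proj_comp, add_comm m g]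
    module
  have e2 : ‖ηz' • P m'‖ ^ 2 = ηz ^ 2 * ‖W (g + m) - P (g + m)‖ ^ 2 := by
    rw [e1, norm_neg, norm_smul, mul_pow, Real.norm_eq_abs, sq_abs]
  have e3 : ‖ηz • P m‖ ^ 2 = ηz ^ 2 * ‖P m‖ ^ 2 := by
    rw [norm_smul, mul_pow, Real.norm_eq_abs, sq_abs]
  have h1 := h.contract (g + m)
  -- Young's inequality with parameter 2χ: the coefficient of ‖P m‖² grows so little that, after the
  -- contraction, half of the gap 1/χ survives (`c2`).
  have h2 : ‖P (g + m)‖ ^ 2 ≤ (1 + 2 * χ) * ‖P g‖ ^ 2 + (1 + 1 / (2 * χ)) * ‖P m‖ ^ 2 := by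
    rw [map_add, norm_add_sq_real]
    have := real_inner_le_norm (P g) (P m)
    have h3 : 2 * (‖P g‖ * ‖P m‖) ≤ 2 * χ * ‖P g‖ ^ 2 + 1 / (2 * χ) * ‖P m‖ ^ 2 := by
      have h4 : 0 ≤ 1 / (2 * χ) * (2 * χ * ‖P g‖ - ‖P m‖) ^ 2 := by positivity
      have h5 : 1 / (2 * χ) * (2 * χ * ‖P g‖ - ‖P m‖) ^ 2
        = 2 * χ * ‖P g‖ ^ 2 - 2 * (‖P g‖ * ‖P m‖) + 1 / (2 * χ) * ‖P m‖ ^ 2 := by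
        field_simp; ring
      linarith
    linarith
  have hi : 1 / χ ≤ 1 := by rw [div_le_one hχ0]; exact hχ
  have h3 := h1.trans (mul_le_mul_of_nonneg_left h2 (sub_nonneg.2 hi))
  have c1 : (1 - 1 / χ) * (1 + 2 * χ) ≤ 2 * χ := by
    have : (1 - 1 / χ) * (1 + 2 * χ) = 2 * χ - 1 - 1 / χ := by field_simp; ring
    have : 0 < 1 / χ := by positivity
    linarith
  have c2 : (1 - 1 / χ) * (1 + 1 / (2 * χ)) ≤ 1 - 1 / (2 * χ) := by
    have e : (1 - 1 / χ) * (1 + 1 / (2 * χ)) = 1 - 1 / (2 * χ) - 1 / (2 * χ ^ 2) := by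
      field_simp; ring
    have : 0 < 1 / (2 * χ ^ 2) := by positivity
    linarith
  have h4 : ‖W (g + m) - P (g + m)‖ ^ 2
      ≤ (1 - 1 / (2 * χ)) * ‖P m‖ ^ 2 + 2 * χ * ‖P g‖ ^ 2 := by
    have := mul_le_mul_of_nonneg_right c1 (sq_nonneg ‖P g‖)
    have := mul_le_mul_of_nonneg_right c2 (sq_nonneg ‖P m‖)
    linarith
  rw [e2, e3]
  have := mul_le_mul_of_nonneg_left h4 (sq_nonneg ηz)
  linarith

/-- The potential of the dual variables. -/
noncomputable def dualPotential (P : E →ₗ[ℝ] E) (ρ χ ηz : ℝ) (yc zc y z m : E) : ℝ :=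
  2 * ρ * ‖y - yc‖ ^ 2 + 5 * ρ * χ ^ 2 * (‖z - ηz • P m - zc‖ ^ 2 + ‖ηz • P m‖ ^ 2)

/-- One round of the dual updates. -/
theorem dual_step (h : IsGossipOperator P W χ) {ρ α ηz ηz' : ℝ} (hρ : 0 < ρ) (hα : 0 < α)
    (hα1 : α ≤ 1) (hηz : ηz = 1 / (10 * ρ * χ ^ 2) / α) (hη' : ηz' ≠ 0)
    {y yb yU y' yb' yc z zb zU z' zb' zc m m' g xh : E}
    (hyU : yU = α • y + (1 - α) • yb) (hzU : zU = α • z + (1 - α) • zb)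
    (hg : g = ρ • (yU + zU)) (hy : y' = y - (1 / (4 * ρ) / α) • (g + xh))
    (hz : z' = z - ηz • W (g + m)) (hyb : yb' = yU + α • (y' - y))
    (hzb : zb' = zU - (1 / (2 * ρ)) • W g) (hm : m' = (ηz / ηz') • (m + g - W (g + m)))
    (hPz : P z = z) (hPzc : P zc = zc) :
    1 / α ^ 2 * (ρ / 2 * ‖yb' + zb'‖ ^ 2) ≤
      (1 - α) / α ^ 2 * (ρ / 2 * ‖yb + zb‖ ^ 2) + 1 / α * (ρ / 2 * ‖yc + zc‖ ^ 2)
      - 1 / α * inner ℝ xh (y' - yc) - ρ * ‖y' - y‖ ^ 2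
      + dualPotential P ρ χ ηz yc zc y z m - dualPotential P ρ χ ηz' yc zc y' z' m' := by
  have hχ := h.one_le
  have hχ0 : 0 < χ := by linarith
  have hdes := h.descent (yc := yc) (zc := zc) hρ hα.le hα1 hyU hzU hg hyb hzb
  have herr := h.norm_error_sq_le hη' hm
  -- the mirror descent step for `y`
  have hymir : 1 / α * inner ℝ g (y' - yc) = -(1 / α * inner ℝ xh (y' - yc))
      - 2 * ρ * (‖y' - yc‖ ^ 2 + ‖y' - y‖ ^ 2 - ‖y - yc‖ ^ 2) := by
    have e1 : inner ℝ (y' - y) (y' - yc)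
        = (‖y' - yc‖ ^ 2 + ‖y' - y‖ ^ 2 - ‖y - yc‖ ^ 2) / 2 := by
      simp only [← real_inner_self_eq_norm_sq, inner_sub_left, inner_sub_right, real_inner_comm]
      ring
    have e2 : y' - y = -((1 / (4 * ρ) / α) • (g + xh)) := by rw [hy]; abel
    have e3 : inner ℝ (y' - y) (y' - yc)
        = -(1 / (4 * ρ) / α * (inner ℝ g (y' - yc) + inner ℝ xh (y' - yc))) := by
      nth_rw 1 [e2]
      rw [inner_neg_left, real_inner_smul_left, inner_add_left]
    have e4 : 2 * ρ * (‖y' - yc‖ ^ 2 + ‖y' - y‖ ^ 2 - ‖y - yc‖ ^ 2)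
        = -(1 / α * (inner ℝ g (y' - yc) + inner ℝ xh (y' - yc))) := by
      have : 2 * ρ * (‖y' - yc‖ ^ 2 + ‖y' - y‖ ^ 2 - ‖y - yc‖ ^ 2)
        = 4 * ρ * inner ℝ (y' - y) (y' - yc) := by rw [e1]; ring
      rw [this, e3]
      field_simp
    rw [e4]; ring
  -- the mirror descent step for the virtual iterates
  set e := ηz • P m with he
  set e' := ηz' • P m' with he'
  -- The reason for error feedback: m stores what gossip failed to transmit, so z - e moves by the
  -- exact projected gradient although z itself does not.
  have hez : z' - e' = z - e - ηz • P g := by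
    rw [hz, he', he, hm, map_smul, smul_smul, mul_div_cancel₀ _ hη', map_sub, h.proj_comp, map_add P m g]
    module
  have hzmir : ‖z' - e' - zc‖ ^ 2 = ‖z - e - zc‖ ^ 2 - 2 * ηz * inner ℝ g (z - zc)
      + 2 * ηz * inner ℝ (P g) e + ηz ^ 2 * ‖P g‖ ^ 2 := by
    have e1 : inner ℝ (P g) (z - zc) = inner ℝ g (z - zc) :=
      h.inner_proj (by rw [map_sub, hPz, hPzc])
    rw [hez, ← e1]
    simp only [← real_inner_self_eq_norm_sq, inner_sub_left, inner_sub_right,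
      real_inner_smul_right, real_inner_comm]
    ring
  -- The parameter is chosen so that the ‖e‖² term equals the decay of the compression error in
  -- `herr2`.
  have hcross : 1 / α * inner ℝ (P g) e
      ≤ 1 / (10 * ρ * χ) / α ^ 2 * ‖P g‖ ^ 2 + 5 * ρ * χ / 2 * ‖e‖ ^ 2 := by
    have h1 := mul_le_mul_of_nonneg_left (real_inner_le_norm (P g) e)
      (by positivity : 0 ≤ 1 / α)
    have h2 : 0 ≤ 1 / (10 * ρ * χ) * (1 / α * ‖P g‖ - 5 * ρ * χ * ‖e‖) ^ 2 := by positivity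
    have h3 : 1 / (10 * ρ * χ) * (1 / α * ‖P g‖ - 5 * ρ * χ * ‖e‖) ^ 2
        = 1 / (10 * ρ * χ) / α ^ 2 * ‖P g‖ ^ 2 + 5 * ρ * χ / 2 * ‖e‖ ^ 2
          - 1 / α * (‖P g‖ * ‖e‖) := by
      field_simp; ring
    linarith
  have hzfin : 1 / α * inner ℝ g (z - zc) = 5 * ρ * χ ^ 2 *
      (‖z - e - zc‖ ^ 2 - ‖z' - e' - zc‖ ^ 2) + 1 / α * inner ℝ (P g) e
      + 1 / (20 * ρ * χ ^ 2) / α ^ 2 * ‖P g‖ ^ 2 := by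
    rw [hzmir, hηz]
    field_simp
    ring
  have herr2 : 5 * ρ * χ ^ 2 * ‖e'‖ ^ 2 ≤ 5 * ρ * χ ^ 2 * ‖e‖ ^ 2 - 5 * ρ * χ / 2 * ‖e‖ ^ 2
      + 1 / (10 * ρ * χ) / α ^ 2 * ‖P g‖ ^ 2 := by
    refine (mul_le_mul_of_nonneg_left herr (by positivity : 0 ≤ 5 * ρ * χ ^ 2)).trans_eq ?_
    rw [hηz]
    field_simp
    ring
  have hdes2 := mul_le_mul_of_nonneg_left hdes (by positivity : 0 ≤ 1 / α ^ 2)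
  have hexp : 1 / α ^ 2 * ((1 - α) * (ρ / 2 * ‖yb + zb‖ ^ 2) + α * (ρ / 2 * ‖yc + zc‖ ^ 2)
      + α * inner ℝ g (y' - yc) + α * inner ℝ g (z - zc) + ρ * α ^ 2 * ‖y' - y‖ ^ 2
      - 1 / (4 * ρ * χ) * ‖P g‖ ^ 2)
      = (1 - α) / α ^ 2 * (ρ / 2 * ‖yb + zb‖ ^ 2) + 1 / α * (ρ / 2 * ‖yc + zc‖ ^ 2)
      + 1 / α * inner ℝ g (y' - yc) + 1 / α * inner ℝ g (z - zc) + ρ * ‖y' - y‖ ^ 2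
      - 1 / (4 * ρ * χ) / α ^ 2 * ‖P g‖ ^ 2 := by
    field_simp
  rw [hexp, hymir, hzfin] at hdes2
  -- The descent term must pay for three things: the cross term with e, the growth of the
  -- compression error, and the square of the virtual step. The constant 10 in `ηz` makes this 1/10
  -- + 1/10 + 1/(20χ) ≤ 1/4.
  have hbud : 1 / (10 * ρ * χ) / α ^ 2 * ‖P g‖ ^ 2 + 1 / (10 * ρ * χ) / α ^ 2 * ‖P g‖ ^ 2
      + 1 / (20 * ρ * χ ^ 2) / α ^ 2 * ‖P g‖ ^ 2 ≤ 1 / (4 * ρ * χ) / α ^ 2 * ‖P g‖ ^ 2 := by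
    rw [← add_mul, ← add_mul]
    refine mul_le_mul_of_nonneg_right ?_ (sq_nonneg _)
    rw [← add_div, ← add_div]
    refine div_le_div_of_nonneg_right ?_ (sq_nonneg _)
    have : 1 / (4 * ρ * χ) - (1 / (10 * ρ * χ) + 1 / (10 * ρ * χ) + 1 / (20 * ρ * χ ^ 2))
        = (χ - 1) / (20 * ρ * χ ^ 2) := by field_simp; ring
    have : 0 ≤ (χ - 1) / (20 * ρ * χ ^ 2) := div_nonneg (by linarith) (by positivity)
    linarith
  unfold dualPotential
  rw [← he, ← he']
  linarith

end IsGossipOperator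

end InnerProduct

/-! ### The primal-dual potential -/

section InnerProduct

variable {E : Type*} [NormedAddCommGroup E] [InnerProductSpace ℝ E]

/-- The gap of the Lagrangian
`q x + ‖x‖² / 3 - ⟪y, x⟫ - (3/2) ‖y + z‖²` between `(x, yc, zc)` and `(xs, y, z)`. -/
noncomputable def lagrangianGap (q : E → ℝ) (xs yc zc x y z : E) : ℝ :=
  q x + 1 / 3 * ‖x‖ ^ 2 - 1 / 3 * ‖xs‖ ^ 2 - inner ℝ yc x + inner ℝ y xs
    + 3 / 2 * ‖y + z‖ ^ 2 - 3 / 2 * ‖yc + zc‖ ^ 2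

/-- The potential of the primal-dual method; `v` is the last primal increment. -/
noncomputable def primalDualPotential (P : E →ₗ[ℝ] E) (χ α ηz : ℝ) (xs yc zc x v y z m : E) : ℝ :=
  1 / (3 * α ^ 2) * ‖x - xs‖ ^ 2 + IsGossipOperator.dualPotential P 3 χ ηz yc zc y z m
    + 1 / 12 * ‖v‖ ^ 2 - inner ℝ (y - yc) v

/-- The only negative term, the inner product with v, is dominated by 6‖y - yc‖² (from the dual
potential with ρ = 3) and ‖v‖²/12. -/
theorem primalDualPotential_nonneg (P : E →ₗ[ℝ] E) (χ α ηz : ℝ) (xs yc zc x v y z m : E) :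
    0 ≤ primalDualPotential P χ α ηz xs yc zc x v y z m := by
  unfold primalDualPotential IsGossipOperator.dualPotential
  have h1 := real_inner_le_norm (y - yc) v
  have h2 : 0 ≤ 1 / (3 * α ^ 2) * ‖x - xs‖ ^ 2 := by positivity
  have h3 : 0 ≤ 5 * 3 * χ ^ 2 * (‖z - ηz • P m - zc‖ ^ 2 + ‖ηz • P m‖ ^ 2) := by positivity
  nlinarith [sq_nonneg (6 * ‖y - yc‖ - ‖v‖), sq_nonneg ‖y - yc‖]

/-- The part in x is convex and the part in y outside the quadratic is linear, so both pass to the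
averaged iterates with weights α and 1 - α. The quadratic in y + z is carried along unchanged, to be
bounded by `dual_step`. -/
theorem ConvexOn.lagrangianGap_step {q : E → ℝ} (hqc : ConvexOn ℝ univ q) {α : ℝ} (hα : 0 < α)
    (hα1 : α ≤ 1) {xs yc zc y' xt' xb xb' yb yb' zb zb' y yU : E}
    (hyU : yU = α • y + (1 - α) • yb) (hyb : yb' = yU + α • (y' - y))
    (hxb : xb' = α • xt' + (1 - α) • xb) :
    1 / α ^ 2 * lagrangianGap q xs yc zc xb' yb' zb'
      - (1 - α) / α ^ 2 * lagrangianGap q xs yc zc xb yb zb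
      ≤ 1 / α * (q xt' + 1 / 3 * ‖xt'‖ ^ 2 - 1 / 3 * ‖xs‖ ^ 2 - inner ℝ yc xt' + inner ℝ y' xs)
      + (1 / α ^ 2 * (3 / 2 * ‖yb' + zb'‖ ^ 2) - (1 - α) / α ^ 2 * (3 / 2 * ‖yb + zb‖ ^ 2)
        - 1 / α * (3 / 2 * ‖yc + zc‖ ^ 2)) := by
  have hsq : ConvexOn ℝ univ (fun w : E => ‖w‖ ^ 2) := by
    simpa using convexOn_norm_sub_sq (0 : E)
  have h1 := hqc.2 (mem_univ xt') (mem_univ xb) hα.le (sub_nonneg.2 hα1) (by ring)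
  have h2 := hsq.2 (mem_univ xt') (mem_univ xb) hα.le (sub_nonneg.2 hα1) (by ring)
  have h3 : inner ℝ yc xb' = α * inner ℝ yc xt' + (1 - α) * inner ℝ yc xb := by
    rw [hxb, inner_add_right, real_inner_smul_right, real_inner_smul_right]
  have h4 : inner ℝ yb' xs = α * inner ℝ y' xs + (1 - α) * inner ℝ yb xs := by
    rw [hyb, hyU]
    simp only [inner_add_left, inner_sub_left, real_inner_smul_left]
    ring
  rw [← hxb] at h1 h2
  simp only [smul_eq_mul] at h1 h2
  unfold lagrangianGap
  rw [h3, h4]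
  have h5 := mul_le_mul_of_nonneg_left h1 (by positivity : 0 ≤ 1 / α ^ 2)
  have h6 := mul_le_mul_of_nonneg_left h2 (by positivity : 0 ≤ 1 / α ^ 2 * (1 / 3))
  have e : ∀ a b : ℝ, 1 / α ^ 2 * (α * a + (1 - α) * b) = 1 / α * a + (1 - α) / α ^ 2 * b := by
    intro a b; field_simp
  have e' : ∀ a b : ℝ, 1 / α ^ 2 * (1 / 3) * (α * a + (1 - α) * b)
      = 1 / 3 * (1 / α * a + (1 - α) / α ^ 2 * b) := by
    intro a b; field_simp
  rw [e] at h5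
  rw [e'] at h6
  have e3 := e (inner ℝ yc xt') (inner ℝ yc xb)
  have e4 := e (inner ℝ y' xs) (inner ℝ yb xs)
  have e5 : ∀ c : ℝ, 1 / α ^ 2 * c = 1 / α * c + (1 - α) / α ^ 2 * c := by
    intro c; field_simp; ring
  have e6 := e5 (‖xs‖ ^ 2)
  have e7 := e5 (‖yc + zc‖ ^ 2)
  linarith

/-- One outer iteration decreases the potential. -/
theorem IsGossipOperator.primal_dual_step {P W : E →ₗ[ℝ] E} {χ : ℝ} (h : IsGossipOperator P W χ)
    {q : E → ℝ} (hqc : ConvexOn ℝ univ q) {α α₀ α₁ ηz ηz' τ err : ℝ} (hα : 0 < α) (hα1 : α ≤ 1)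
    (hα' : 1 / α₁ ^ 2 ≤ 1 / α ^ 2 + 1 / α) (hηz : ηz = 1 / (10 * 3 * χ ^ 2) / α)
    (hη' : ηz' ≠ 0) (hτ : τ = 1 / (3 * α))
    {xs x xp xt xt' x' xb xb' y yb yU y' yb' yc z zb zU z' zb' zc m m' g xh : E}
    (hyU : yU = α • y + (1 - α) • yb) (hzU : zU = α • z + (1 - α) • zb)
    (hg : g = (3 : ℝ) • (yU + zU)) (hy : y' = y - (1 / (4 * 3) / α) • (g + xh))
    (hz : z' = z - ηz • W (g + m)) (hyb : yb' = yU + α • (y' - y))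
    (hzb : zb' = zU - (1 / (2 * 3) : ℝ) • W g) (hm : m' = (ηz / ηz') • (m + g - W (g + m)))
    (hPz : P z = z) (hPzc : P zc = zc)
    (hxh : xh = x + (α / α₀) • (xt - xp)) (hxb : xb' = α • xt' + (1 - α) • xb)
    (hx : q xt' + 1 / 3 * ‖xt'‖ ^ 2 - 1 / 3 * ‖xs‖ ^ 2 - inner ℝ y' (xt' - xs)
      + τ / 2 * ‖xt' - x‖ ^ 2 + (τ + 1 / 3) * ‖x' - xs‖ ^ 2 ≤ τ * ‖x - xs‖ ^ 2 + err) :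
    1 / α ^ 2 * lagrangianGap q xs yc zc xb' yb' zb' ≤
      (1 - α) / α ^ 2 * lagrangianGap q xs yc zc xb yb zb
      + primalDualPotential P χ α ηz xs yc zc x ((1 / α₀) • (xt - xp)) y z m
      - primalDualPotential P χ α₁ ηz' xs yc zc x' ((1 / α) • (xt' - x)) y' z' m'
      + 1 / α * err := by
  have hdual := h.dual_step (yc := yc) (by norm_num : (0 : ℝ) < 3) hα hα1 hηz hη' hyU hzU hg hy hz
    hyb hzb hm hPz hPzc
  have hlag := hqc.lagrangianGap_step (xs := xs) (yc := yc) (zc := zc) (zb := zb) (zb' := zb')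
    hα hα1 hyU hyb hxb
  have hx2 := mul_le_mul_of_nonneg_left hx (by positivity : 0 ≤ 1 / α)
  set v := (1 / α₀) • (xt - xp) with hv
  set v' := (1 / α) • (xt' - x) with hv'
  -- The extrapolation is designed for this: the error of predicting the new primal point is a
  -- difference of consecutive normalized increments.
  have hvv : v' - v = (1 / α) • (xt' - xh) := by
    rw [hv, hv', hxh]
    have : (1 / α₀ : ℝ) = 1 / α * (α / α₀) := by field_simp
    rw [this]
    module
  have hnv : ‖v'‖ ^ 2 = 1 / α ^ 2 * ‖xt' - x‖ ^ 2 := by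
    rw [hv', norm_smul, mul_pow, Real.norm_eq_abs, sq_abs]; ring
  -- Hence the bilinear coupling telescopes, apart from ⟪y' - y, v⟫, which Young's inequality splits
  -- between the -3‖y' - y‖² of `dual_step` and the ‖v‖²/12 of the potential.
  have hcoup : 1 / α * inner ℝ y' (xt' - xs) - 1 / α * inner ℝ xh (y' - yc)
      = inner ℝ (y' - yc) v' - inner ℝ (y - yc) v - inner ℝ (y' - y) v
        + 1 / α * inner ℝ yc xt' - 1 / α * inner ℝ y' xs := by
    have e1 : inner ℝ (y' - yc) (v' - v) = 1 / α * inner ℝ (y' - yc) (xt' - xh) := by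
      rw [hvv, real_inner_smul_right]
    have e2 : inner ℝ (y' - yc) (v' - v)
        = inner ℝ (y' - yc) v' - inner ℝ (y - yc) v - inner ℝ (y' - y) v := by
      simp only [inner_sub_left, inner_sub_right]; ring
    rw [← e2, e1]
    simp only [inner_sub_left, inner_sub_right, real_inner_comm]
    ring
  have hyoung : -inner ℝ (y' - y) v ≤ 3 * ‖y' - y‖ ^ 2 + 1 / 12 * ‖v‖ ^ 2 := by
    have h1 := neg_le_of_abs_le (abs_real_inner_le_norm (y' - y) v)
    nlinarith [sq_nonneg (6 * ‖y' - y‖ - ‖v‖)]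
  -- The strong convexity 1/3 kept in the primal part allows the weight 1/α² of the distance to
  -- grow.
  have hD : 1 / (3 * α₁ ^ 2) * ‖x' - xs‖ ^ 2 ≤ 1 / α * ((τ + 1 / 3) * ‖x' - xs‖ ^ 2) := by
    have := mul_le_mul_of_nonneg_right hα' (sq_nonneg ‖x' - xs‖)
    have e1 : 1 / (3 * α₁ ^ 2) * ‖x' - xs‖ ^ 2 = 1 / 3 * (1 / α₁ ^ 2 * ‖x' - xs‖ ^ 2) := by
      rw [one_div, mul_inv]; ring
    have e2 : 1 / α * ((τ + 1 / 3) * ‖x' - xs‖ ^ 2)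
        = 1 / 3 * ((1 / α ^ 2 + 1 / α) * ‖x' - xs‖ ^ 2) := by
      rw [hτ]; field_simp
    rw [e1, e2]
    linarith
  have e1 : 1 / α * (τ * ‖x - xs‖ ^ 2) = 1 / (3 * α ^ 2) * ‖x - xs‖ ^ 2 := by
    rw [hτ]; field_simp
  have e2 : 1 / α * (τ / 2 * ‖xt' - x‖ ^ 2) = 1 / 6 * ‖v'‖ ^ 2 := by
    rw [hτ, hnv]; field_simp; ring
  have hpos := sq_nonneg ‖v'‖
  unfold primalDualPotential
  linarith

end InnerProduct

/-- Summation by parts; `d 0 = 0` removes the initial value. The resulting coefficients are the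
output weights. -/
theorem sum_weighted_telescope (c Ψ : ℕ → ℝ) (d : ℕ → ℝ) (hd : d 0 = 0) (N : ℕ) :
    ∑ k ∈ Finset.range (N + 1), (c k * Ψ (k + 1) - d k * Ψ k)
      = ∑ k ∈ Finset.Icc 1 N, (c (k - 1) - d k) * Ψ k + c N * Ψ (N + 1) := by
  induction N with
  | zero => simp [hd]
  | succ N ih =>
    rw [Finset.sum_range_succ, ih, Finset.sum_Icc_succ_top (by omega)]
    simp only [Nat.add_sub_cancel]
    ring

/-! ### Tuples over the network and one outer iteration -/

section Network

variable {n : ℕ} {V : Type*} [NormedAddCommGroup V] [InnerProductSpace ℝ V]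

/-- `n`-tuples with the Euclidean norm. -/
abbrev NodeSpace (n : ℕ) (V : Type*) : Type _ := PiLp 2 (fun _ : Fin n => V)

/-- The gossip operator `W ⊗ I`. -/
def gossipMap (V : Type*) [NormedAddCommGroup V] [InnerProductSpace ℝ V]
    (W : Matrix (Fin n) (Fin n) ℝ) : NodeSpace n V →ₗ[ℝ] NodeSpace n V where
  toFun v := WithLp.toLp 2 (gossip W v.ofLp)
  map_add' v w := by
    ext i
    simp [gossip, Finset.sum_add_distrib]
  map_smul' c v := by
    ext i
    simp [gossip, Finset.smul_sum, smul_comm c]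

/-- The orthogonal projection onto the tuples of sum zero. -/
noncomputable def consensusProj (n : ℕ) (V : Type*) [NormedAddCommGroup V]
    [InnerProductSpace ℝ V] : NodeSpace n V →ₗ[ℝ] NodeSpace n V where
  toFun v := WithLp.toLp 2 (fun i => v i - (1 / (n : ℝ)) • ∑ j, v j)
  map_add' v w := by
    ext i
    simp [Finset.sum_add_distrib]
    abel
  map_smul' c v := by
    ext i
    simp [← Finset.smul_sum, smul_sub, smul_comm c]

@[simp] theorem gossipMap_apply (W : Matrix (Fin n) (Fin n) ℝ) (v : NodeSpace n V) (i : Fin n) :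
    gossipMap V W v i = ∑ j, W i j • v j := rfl

@[simp] theorem consensusProj_apply (v : NodeSpace n V) (i : Fin n) :
    consensusProj n V v i = v i - (1 / (n : ℝ)) • ∑ j, v j := rfl

theorem NodeSpace.inner_eq (v w : NodeSpace n V) : inner ℝ v w = ∑ i, inner ℝ (v i) (w i) :=
  PiLp.inner_apply v w

theorem sum_consensusProj (hn : 0 < n) (v : NodeSpace n V) :
    ∑ i, consensusProj n V v i = 0 := by
  have : (n : ℝ) ≠ 0 := by positivity
  simp only [consensusProj_apply, Finset.sum_sub_distrib, Finset.sum_const, Finset.card_univ,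
    Fintype.card_fin]
  rw [← Nat.cast_smul_eq_nsmul ℝ, smul_smul, mul_one_div_cancel this, one_smul, sub_self]

theorem consensusProj_eq_self {v : NodeSpace n V} (h : ∑ i, v i = 0) :
    consensusProj n V v = v := by
  ext i
  simp [h]

/-- The matrix acts on the node index only, so the scalar inequality applies to each coordinate in
an orthonormal basis of V, and the coordinates are summed. -/
theorem sum_sq_gossip_sub_le [FiniteDimensional ℝ V] {W : Matrix (Fin n) (Fin n) ℝ} {c : ℝ}
    (hW : ∀ x : Fin n → ℝ, ∑ i, x i = 0 →
      ∑ i, ((W *ᵥ x) i - x i) ^ 2 ≤ c * ∑ i, x i ^ 2)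
    (v : Fin n → V) (hv : ∑ i, v i = 0) :
    ∑ i, ‖gossip W v i - v i‖ ^ 2 ≤ c * ∑ i, ‖v i‖ ^ 2 := by
  let b := stdOrthonormalBasis ℝ V
  have hb : ∀ w : V, ‖w‖ ^ 2 = ∑ j, inner ℝ (b j) w ^ 2 := by
    intro w
    rw [← b.sum_sq_norm_inner_right w]
    simp
  simp only [hb]
  rw [Finset.sum_comm, Finset.sum_comm (γ := Fin n), Finset.mul_sum]
  refine Finset.sum_le_sum fun j _ => ?_
  have := hW (fun i => inner ℝ (b j) (v i)) (by rw [← inner_sum, hv, inner_zero_right])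
  refine le_trans (le_of_eq ?_) this
  refine Finset.sum_congr rfl fun i _ => ?_
  rw [inner_sub_right, gossip, inner_sum]
  simp [Matrix.mulVec, dotProduct, real_inner_smul_right]

/-- Zero row sums make W annihilate constant tuples, whence W P = W; zero column sums put its range
in the sum-zero tuples, whence P W = W. -/
theorem isGossipOperator_gossipMap [FiniteDimensional ℝ V] (hn : 0 < n)
    {W : Matrix (Fin n) (Fin n) ℝ} {χ : ℝ} (h1 : W *ᵥ 1 = 0) (h2 : Wᵀ *ᵥ 1 = 0) (hχ : 1 ≤ χ)
    (hW : ∀ x : Fin n → ℝ, ∑ i, x i = 0 →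
      ∑ i, ((W *ᵥ x) i - x i) ^ 2 ≤ (1 - 1 / χ) * ∑ i, x i ^ 2) :
    IsGossipOperator (consensusProj n V) (gossipMap V W) χ := by
  have hrow : ∀ i, ∑ j, W i j = 0 := fun i => by
    simpa [Matrix.mulVec, dotProduct] using congrFun h1 i
  have hcol : ∀ j, ∑ i, W i j = 0 := fun j => by
    simpa [Matrix.mulVec, dotProduct] using congrFun h2 j
  have hcomp : ∀ v : NodeSpace n V, gossipMap V W (consensusProj n V v) = gossipMap V W v := by
    intro v
    ext i
    simp only [gossipMap_apply, consensusProj_apply, smul_sub, Finset.sum_sub_distrib]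
    rw [← Finset.sum_smul, hrow, zero_smul, sub_zero]
  have hproj : ∀ v : NodeSpace n V, ∑ i, gossipMap V W v i = 0 := by
    intro v
    simp only [gossipMap_apply]
    rw [Finset.sum_comm]
    simp only [← Finset.sum_smul, hcol, zero_smul, Finset.sum_const_zero]
  refine ⟨fun v w => ?_, fun v => consensusProj_eq_self (sum_consensusProj hn v),
    fun v => consensusProj_eq_self (hproj v), hcomp, hχ, fun v => ?_⟩
  · simp only [NodeSpace.inner_eq, consensusProj_apply, inner_sub_left, inner_sub_right,
      Finset.sum_sub_distrib, real_inner_smul_left, real_inner_smul_right]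
    congr 1
    rw [← Finset.mul_sum, ← Finset.mul_sum, ← inner_sum, ← sum_inner]
  · rw [← hcomp, PiLp.norm_sq_eq_of_L2, PiLp.norm_sq_eq_of_L2]
    exact sum_sq_gossip_sub_le hW (consensusProj n V v).ofLp (sum_consensusProj hn v)

/-- The iterates of the inner loop of outer iteration `k`. -/
noncomputable def innerPoint (P : AlgParams) (T : ℕ) (W : ℕ → Matrix (Fin n) (Fin n) ℝ)
    (g : ℕ → ℕ → Fin n → V → V) (k : ℕ) : ℕ → Fin n → V :=
  innerIter (P.ηx k) (P.β k) (P.τx k) (g k) (algState P T 0 0 0 0 W g k).x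
    (algState P T 0 0 0 0 W g (k + 1)).y

/-- The contribution of outer iteration `k` to the error, for oracle noise `δ t` at `u t`. -/
noncomputable def oracleError (L η : ℝ) (T : ℕ) (xs : NodeSpace n V) (δ u : ℕ → NodeSpace n V) :
    ℝ :=
  (1 / (T : ℝ)) * ∑ t ∈ Finset.range T,
    (inner ℝ (δ t) (xs - u t) + η / 2 * (2 * L + ‖δ t‖) ^ 2)

/-- One outer iteration of the algorithm. -/
theorem outerStep_potential {χ L : ℝ} {K T : ℕ} (hT : 1 ≤ T)
    {W : ℕ → Matrix (Fin n) (Fin n) ℝ}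
    (hW : ∀ k, IsGossipOperator (consensusProj n V) (gossipMap V (W k)) χ)
    {q : NodeSpace n V → ℝ} (hqc : ConvexOn ℝ univ q) (hq : ∀ u u', q u' - q u ≤ L * ‖u' - u‖)
    {xs : NodeSpace n V} {gm : NodeSpace n V → NodeSpace n V}
    (hgm : ∀ u, q u ≤ inner ℝ (gm u) (u - xs)) (hL : ∀ u, ‖gm u‖ ≤ L)
    (g : ℕ → ℕ → Fin n → V → V) (k : ℕ) (s : AlgState n V)
    (yc zc : NodeSpace n V) (hPz : consensusProj n V (WithLp.toLp 2 s.z) = WithLp.toLp 2 s.z)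
    (hPzc : consensusProj n V zc = zc) :
    let P := stdParams 1 χ K T
    let s' := outerStep P T k (W k) (g k) s
    let u : ℕ → NodeSpace n V := fun t =>
      WithLp.toLp 2 (innerIter (P.ηx k) (P.β k) (P.τx k) (g k) s.x s'.y t)
    let δ : ℕ → NodeSpace n V := fun t => WithLp.toLp 2 (fun i => g k t i (u t i)) - gm (u t)
    1 / P.α k ^ 2 * lagrangianGap q xs yc zc (WithLp.toLp 2 s'.xBar) (WithLp.toLp 2 s'.yBar)
        (WithLp.toLp 2 s'.zBar) ≤
      (1 - P.α k) / P.α k ^ 2 * lagrangianGap q xs yc zc (WithLp.toLp 2 s.xBar)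
        (WithLp.toLp 2 s.yBar) (WithLp.toLp 2 s.zBar)
      + primalDualPotential (consensusProj n V) χ (P.α k) (P.ηz k) xs yc zc (WithLp.toLp 2 s.x)
          ((1 / (3 / ((k : ℝ) + 2))) • (WithLp.toLp 2 s.xTilde - WithLp.toLp 2 s.xPrev))
          (WithLp.toLp 2 s.y) (WithLp.toLp 2 s.z) (WithLp.toLp 2 s.m)
      - primalDualPotential (consensusProj n V) χ (P.α (k + 1)) (P.ηz (k + 1)) xs yc zc
          (WithLp.toLp 2 s'.x)
          ((1 / P.α k) • (WithLp.toLp 2 s'.xTilde - WithLp.toLp 2 s'.xPrev))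
          (WithLp.toLp 2 s'.y) (WithLp.toLp 2 s'.z) (WithLp.toLp 2 s'.m)
      + 1 / P.α k * oracleError L (P.ηx k) T xs δ u := by
  intro P s' u δ
  have hk : (0 : ℝ) ≤ k := Nat.cast_nonneg k
  have hT0 : (0 : ℝ) < T := by exact_mod_cast hT
  have hχ : 0 < χ := lt_of_lt_of_le one_pos (hW 0).one_le
  have hα : P.α k = 3 / ((k : ℝ) + 3) := rfl
  have hαs : P.α (k + 1) = 3 / ((k : ℝ) + 1 + 3) := by
    change 3 / (((k + 1 : ℕ) : ℝ) + 3) = _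
    push_cast; ring
  have hα0 : 0 < P.α k := by rw [hα]; positivity
  have hτ : P.τx k = 1 / (3 * P.α k) := by
    change (2 / 3 * 1 / 2) / P.α k = _
    field_simp
  have hτ0 : 0 < P.τx k := by rw [hτ]; positivity
  have hβ : P.β k = 2 / 3 := by change 2 / 3 * (1 : ℝ) = _; norm_num
  have hηx : P.ηx k = 1 / (P.τx k * T) := rfl
  have hηx0 : 0 < P.ηx k := by rw [hηx]; positivity
  have hσ : P.σ k = P.τx k / (2 * P.τx k + P.β k) := rfl
  let yU := P.α k • s.y + (1 - P.α k) • s.yBar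
  let zU := P.α k • s.z + (1 - P.α k) • s.zBar
  let xh := s.x + P.γ k • (s.xTilde - s.xPrev)
  have hinner := prox_subgradient_average (q := q) hqc (L := L) (xs := xs)
    (a := WithLp.toLp 2 s.x) (y := WithLp.toLp 2 s'.y) (u := u)
    (g := fun t => WithLp.toLp 2 (fun i => g k t i (u t i))) (gm := fun t => gm (u t))
    (xt := WithLp.toLp 2 s'.xTilde) (x' := WithLp.toLp 2 s'.x) hT (by rw [hβ]; norm_num) hτ0 hηx hσ
    hq rfl (fun t => hgm _) (fun t => hL _) (fun t => ?_) ?_ rfl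
  · rw [hβ] at hinner
    -- Here 3/(k + 2) stands for α_{k-1}, written without subtraction so that it makes sense at k =
    -- 0. There the increment it multiplies vanishes for the actual initial state.
    refine (hW k).primal_dual_step (α₀ := 3 / ((k : ℝ) + 2)) (τ := P.τx k)
      hqc hα0 ?_ ?_ ?_ ?_ hτ (yU := WithLp.toLp 2 yU) (zU := WithLp.toLp 2 zU)
      (g := (3 : ℝ) • (WithLp.toLp 2 yU + WithLp.toLp 2 zU)) (xh := WithLp.toLp 2 xh)
      rfl rfl rfl ?_ ?_ rfl ?_ ?_ hPz hPzc ?_ rfl ?_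
    · rw [hα, div_le_one (by positivity)]; linarith
    · rw [hα, hαs]
      field_simp
      nlinarith
    · change (1 / (10 * (3 / 1) * χ ^ 2)) / P.α k = _
      norm_num
    · change (1 / (10 * (3 / 1) * χ ^ 2)) / P.α (k + 1) ≠ 0
      rw [hαs]
      positivity
    · change WithLp.toLp 2 (s.y - ((1 / (4 * (3 / 1))) / P.α k) • ((3 / 1 : ℝ) • (yU + zU) + xh)) = _
      rw [div_one]
      rfl
    · change WithLp.toLp 2 (s.z - P.ηz k • gossip (W k) ((3 / 1 : ℝ) • (yU + zU) + s.m)) = _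
      rw [div_one]
      rfl
    · change WithLp.toLp 2 (zU - (1 / (2 * (3 / 1)) : ℝ) • gossip (W k) ((3 / 1 : ℝ) • (yU + zU))) = _
      rw [div_one]
      rfl
    · change WithLp.toLp 2 ((P.ηz k / P.ηz (k + 1)) • (s.m + (3 / 1 : ℝ) • (yU + zU)
        - gossip (W k) ((3 / 1 : ℝ) • (yU + zU) + s.m))) = _
      rw [div_one]
      rfl
    · have hγ : P.γ k = P.α k / (3 / ((k : ℝ) + 2)) := by
        change ((k : ℝ) + 2) / ((k : ℝ) + 3) = _
        rw [hα]; field_simp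
      rw [← hγ]
      rfl
    · refine le_trans (le_of_eq ?_) (hinner.trans_eq ?_)
      · norm_num
      · rfl
  · have := innerUpdate_spec (P.ηx k) (P.β k) (P.τx k) (by rw [hβ]; positivity) s.x s'.y
      (fun i => g k t i (u t i)) (u t).ofLp
    exact congrArg (WithLp.toLp 2) this
  · change WithLp.toLp 2 ((1 / (T : ℝ)) • ∑ t ∈ Finset.Icc 1 T, (u t).ofLp) = _
    rw [WithLp.toLp_smul, WithLp.toLp_sum]

end Network

/-! ### Output weights and summation over a run -/

section Network

variable {n : ℕ} {V : Type*} [NormedAddCommGroup V] [InnerProductSpace ℝ V]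

/-- The weights `lam` are exactly the coefficients left by summation by parts of the one-step
inequality; α_0 = 1 gives the initial gap the coefficient zero. -/
theorem sum_lam_mul {χ : ℝ} {K : ℕ} {T : ℕ} (hK : 1 ≤ K) (Ψ : ℕ → ℝ) :
    let P := stdParams 1 χ K T
    ∑ k ∈ Finset.Icc 1 K, P.lam k * Ψ k
      = ∑ k ∈ Finset.range K, (1 / P.α k ^ 2 * Ψ (k + 1) - (1 - P.α k) / P.α k ^ 2 * Ψ k) := by
  intro P
  have hα0 : P.α 0 = 1 := by
    change 3 / (((0 : ℕ) : ℝ) + 3) = 1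
    norm_num
  obtain ⟨N, rfl⟩ : ∃ N, K = N + 1 := ⟨K - 1, by omega⟩
  rw [sum_weighted_telescope (fun k => 1 / P.α k ^ 2) Ψ (fun k => (1 - P.α k) / P.α k ^ 2)
    (by simp [hα0]), Finset.sum_Icc_succ_top (by omega)]
  congr 1
  · refine Finset.sum_congr rfl fun k hk => ?_
    have hkN : k ≠ N + 1 := by have := (Finset.mem_Icc.1 hk).2; omega
    have hα : P.α k ≠ 0 := by
      change 3 / ((k : ℝ) + 3) ≠ 0
      positivity
    have : P.lam k = (P.α (k - 1) ^ 2)⁻¹ + (P.α k)⁻¹ - (P.α k ^ 2)⁻¹ := if_neg hkN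
    rw [this]
    congr 1
    field_simp
    ring
  · have : P.lam (N + 1) = (P.α (N + 1 - 1) ^ 2)⁻¹ := if_pos rfl
    rw [this, Nat.add_sub_cancel, one_div]

/-- For k ≠ K the weight simplifies to (k + 4)/9. Nonnegativity is needed for Jensen's inequality at
the output. -/
theorem lam_nonneg (χ : ℝ) (K T : ℕ) {k : ℕ} (hk : 1 ≤ k) : 0 ≤ (stdParams 1 χ K T).lam k := by
  have hcast : ((k - 1 : ℕ) : ℝ) = (k : ℝ) - 1 := by push_cast [hk]; ring
  have hk1 : (1 : ℝ) ≤ k := by exact_mod_cast hk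
  by_cases hkK : k = K
  · have : (stdParams 1 χ K T).lam k = ((3 / (((k - 1 : ℕ) : ℝ) + 3)) ^ 2)⁻¹ := if_pos hkK
    rw [this]
    positivity
  · have : (stdParams 1 χ K T).lam k = ((3 / (((k - 1 : ℕ) : ℝ) + 3)) ^ 2)⁻¹
        + (3 / ((k : ℝ) + 3))⁻¹ - ((3 / ((k : ℝ) + 3)) ^ 2)⁻¹ := if_neg hkK
    rw [this, hcast]
    have e : ((3 / ((k : ℝ) - 1 + 3)) ^ 2)⁻¹ + (3 / ((k : ℝ) + 3))⁻¹ - ((3 / ((k : ℝ) + 3)) ^ 2)⁻¹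
        = ((k : ℝ) + 4) / 9 := by
      have : (k : ℝ) - 1 + 3 ≠ 0 := by linarith
      field_simp
      ring
    rw [e]
    positivity

/-- The last weight, (K + 2)²/9, already suffices; this quadratic growth is the accelerated rate. -/
theorem le_sum_lam (χ : ℝ) {K : ℕ} (T : ℕ) (hK : 1 ≤ K) :
    (K : ℝ) ^ 2 / 9 ≤ ∑ k ∈ Finset.Icc 1 K, (stdParams 1 χ K T).lam k := by
  have h1 : (K : ℝ) ^ 2 / 9 ≤ (stdParams 1 χ K T).lam K := by
    have hcast : ((K - 1 : ℕ) : ℝ) = (K : ℝ) - 1 := by push_cast [hK]; ring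
    have hk1 : (1 : ℝ) ≤ K := by exact_mod_cast hK
    have : (stdParams 1 χ K T).lam K = ((3 / (((K - 1 : ℕ) : ℝ) + 3)) ^ 2)⁻¹ := if_pos rfl
    rw [this, hcast, div_pow, inv_div]
    norm_num
    nlinarith
  exact h1.trans (Finset.single_le_sum (f := (stdParams 1 χ K T).lam)
    (fun k hk => lam_nonneg χ K T (Finset.mem_Icc.1 hk).1) (Finset.mem_Icc.2 ⟨hK, le_rfl⟩))

/-- Both variables start at zero and change only by values of the gossip operators and linear
combinations, so they stay in the sum-zero tuples. -/
theorem consensusProj_state {χ : ℝ} {W : ℕ → Matrix (Fin n) (Fin n) ℝ}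
    (hW : ∀ k, IsGossipOperator (consensusProj n V) (gossipMap V (W k)) χ) (P : AlgParams)
    (T : ℕ) (g : ℕ → ℕ → Fin n → V → V) (k : ℕ) :
    let s := algState P T 0 0 0 0 W g k
    consensusProj n V (WithLp.toLp 2 s.z) = WithLp.toLp 2 s.z ∧
      consensusProj n V (WithLp.toLp 2 s.zBar) = WithLp.toLp 2 s.zBar := by
  induction k with
  | zero => exact ⟨map_zero _, map_zero _⟩
  | succ k ih =>
    intro s
    set s₀ := algState P T 0 0 0 0 W g k with hs₀
    obtain ⟨ih1, ih2⟩ := ih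
    set gz : Fin n → V := P.ryz • ((P.α k • s₀.y + (1 - P.α k) • s₀.yBar)
      + (P.α k • s₀.z + (1 - P.α k) • s₀.zBar))
    have e1 : (WithLp.toLp 2 s.z : NodeSpace n V) = WithLp.toLp 2 s₀.z
        - P.ηz k • gossipMap V (W k) (WithLp.toLp 2 (gz + s₀.m)) := rfl
    have e2 : (WithLp.toLp 2 s.zBar : NodeSpace n V) = (P.α k • WithLp.toLp 2 s₀.z
        + (1 - P.α k) • WithLp.toLp 2 s₀.zBar)
        - P.θz k • gossipMap V (W k) (WithLp.toLp 2 gz) := rfl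
    constructor
    · rw [e1, map_sub, map_smul, (hW k).proj_comp, ih1]
    · rw [e2, map_sub, map_smul, (hW k).proj_comp, map_add, map_smul, map_smul, ih1, ih2]

/-- The weighted sum of the Lagrangian gaps along a run of the algorithm. -/
theorem sum_lam_lagrangianGap_le {χ L : ℝ} {K T : ℕ} (hK : 1 ≤ K) (hT : 1 ≤ T)
    {W : ℕ → Matrix (Fin n) (Fin n) ℝ}
    (hW : ∀ k, IsGossipOperator (consensusProj n V) (gossipMap V (W k)) χ)
    {q : NodeSpace n V → ℝ} (hqc : ConvexOn ℝ univ q) (hq : ∀ u u', q u' - q u ≤ L * ‖u' - u‖)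
    {xs : NodeSpace n V} {gm : NodeSpace n V → NodeSpace n V}
    (hgm : ∀ u, q u ≤ inner ℝ (gm u) (u - xs)) (hL : ∀ u, ‖gm u‖ ≤ L)
    (g : ℕ → ℕ → Fin n → V → V) (yc zc : NodeSpace n V) (hPzc : consensusProj n V zc = zc) :
    let P := stdParams 1 χ K T
    let s := algState P T 0 0 0 0 W g
    let u : ℕ → ℕ → NodeSpace n V := fun k t => WithLp.toLp 2 (innerPoint P T W g k t)
    let δ : ℕ → ℕ → NodeSpace n V := fun k t =>
      WithLp.toLp 2 (fun i => g k t i (u k t i)) - gm (u k t)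
    ∑ k ∈ Finset.Icc 1 K, P.lam k * lagrangianGap q xs yc zc (WithLp.toLp 2 (s k).xBar)
        (WithLp.toLp 2 (s k).yBar) (WithLp.toLp 2 (s k).zBar)
      ≤ 1 / 3 * ‖xs‖ ^ 2 + 6 * ‖yc‖ ^ 2 + 15 * χ ^ 2 * ‖zc‖ ^ 2
        + ∑ k ∈ Finset.range K, 1 / P.α k * oracleError L (P.ηx k) T xs (δ k) (u k) := by
  intro P s u δ
  set A : ℕ → ℝ := fun k => primalDualPotential (consensusProj n V) χ (P.α k) (P.ηz k) xs yc zc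
    (WithLp.toLp 2 (s k).x)
    ((1 / (3 / ((k : ℝ) + 2))) • (WithLp.toLp 2 (s k).xTilde - WithLp.toLp 2 (s k).xPrev))
    (WithLp.toLp 2 (s k).y) (WithLp.toLp 2 (s k).z) (WithLp.toLp 2 (s k).m) with hA
  have hstep : ∀ k, 1 / P.α k ^ 2 * lagrangianGap q xs yc zc (WithLp.toLp 2 (s (k + 1)).xBar)
        (WithLp.toLp 2 (s (k + 1)).yBar) (WithLp.toLp 2 (s (k + 1)).zBar)
      - (1 - P.α k) / P.α k ^ 2 * lagrangianGap q xs yc zc (WithLp.toLp 2 (s k).xBar)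
        (WithLp.toLp 2 (s k).yBar) (WithLp.toLp 2 (s k).zBar)
      ≤ (A k - A (k + 1)) + 1 / P.α k * oracleError L (P.ηx k) T xs (δ k) (u k) := by
    intro k
    have h := outerStep_potential (χ := χ) (K := K) hT hW hqc hq hgm hL g k (s k) yc zc
      (consensusProj_state hW P T g k).1 hPzc
    have e : A (k + 1) = primalDualPotential (consensusProj n V) χ (P.α (k + 1)) (P.ηz (k + 1))
        xs yc zc (WithLp.toLp 2 (s (k + 1)).x)
        ((1 / P.α k) • (WithLp.toLp 2 (s (k + 1)).xTilde - WithLp.toLp 2 (s (k + 1)).xPrev))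
        (WithLp.toLp 2 (s (k + 1)).y) (WithLp.toLp 2 (s (k + 1)).z)
        (WithLp.toLp 2 (s (k + 1)).m) := by
      have : P.α k = 3 / (((k + 1 : ℕ) : ℝ) + 2) := by
        change 3 / ((k : ℝ) + 3) = _
        push_cast
        ring
      rw [this]
    rw [e]
    have aux : ∀ {a b c d e : ℝ}, a ≤ b + c - d + e → a - b ≤ c - d + e := by
      intros
      linarith
    exact aux h
  have hA0 : A 0 = 1 / 3 * ‖xs‖ ^ 2 + 6 * ‖yc‖ ^ 2 + 15 * χ ^ 2 * ‖zc‖ ^ 2 := by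
    have h0 : s 0 = ⟨0, 0, 0, 0, 0, 0, 0, 0, 0⟩ := rfl
    have hα0 : P.α 0 = 1 := by
      change 3 / (((0 : ℕ) : ℝ) + 3) = 1
      norm_num
    simp only [hA, h0, primalDualPotential, IsGossipOperator.dualPotential, hα0]
    simp
    ring
  -- The potential telescopes; only its initial value, computed from the zero start, remains.
  have hAK : 0 ≤ A K := primalDualPotential_nonneg _ _ _ _ _ _ _ _ _ _ _ _
  refine (sum_lam_mul hK (fun k => lagrangianGap q xs yc zc (WithLp.toLp 2 (s k).xBar)
    (WithLp.toLp 2 (s k).yBar) (WithLp.toLp 2 (s k).zBar))).trans_le ?_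
  refine (Finset.sum_le_sum fun k _ => hstep k).trans ?_
  rw [Finset.sum_add_distrib, Finset.sum_range_sub', hA0]
  linarith

end Network

/-! ### From the Lagrangian to the gap at the averaged output -/

section NodeSpace

variable {n : ℕ} {V : Type*} [NormedAddCommGroup V]

/-- The tuple with all entries equal to `x`. -/
def nodeConst (n : ℕ) (x : V) : NodeSpace n V := WithLp.toLp 2 (fun _ => x)

theorem norm_nodeConst_sq (x : V) : ‖nodeConst n x‖ ^ 2 = n * ‖x‖ ^ 2 := by
  rw [PiLp.norm_sq_eq_of_L2]
  simp [nodeConst]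

theorem NodeSpace.sum_norm_le (v : NodeSpace n V) : ∑ i, ‖v i‖ ≤ Real.sqrt n * ‖v‖ := by
  have h1 : (∑ i, ‖v i‖) ^ 2 ≤ n * ∑ i, ‖v i‖ ^ 2 := by
    simpa using sq_sum_le_card_mul_sum_sq (s := (Finset.univ : Finset (Fin n)))
      (f := fun i => ‖v i‖)
  refine le_of_sq_le_sq ?_ (by positivity)
  rw [mul_pow, Real.sq_sqrt (Nat.cast_nonneg n), PiLp.norm_sq_eq_of_L2]
  exact h1

end NodeSpace

section Network

variable {n : ℕ} {V : Type*} [NormedAddCommGroup V] [InnerProductSpace ℝ V]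

/-- Convex `L`-Lipschitz functions `q i` vanishing at `xs`, such that `xs` minimizes
`(1/n) ∑ i, q i x + ‖x‖² / 2`, with vector fields `gm i` that bound `q i` from above
as subgradients do. -/
structure NodeProblem (q : Fin n → V → ℝ) (gm : Fin n → V → V) (xs : V) (L : ℝ) : Prop where
  convex : ∀ i, ConvexOn ℝ univ (q i)
  lipschitz : ∀ i x x', q i x' - q i x ≤ L * ‖x' - x‖
  zero : ∀ i, q i xs = 0
  le_inner : ∀ i x, q i x ≤ inner ℝ (gm i x) (x - xs)
  norm_le : ∀ i x, ‖gm i x‖ ≤ L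
  optimal : ∀ x, 1 / 2 * ‖xs‖ ^ 2 ≤ 1 / (n : ℝ) * ∑ i, q i x + 1 / 2 * ‖x‖ ^ 2

/-- The sum of the functions `q i`, on `n`-tuples. -/
def nodeSum (q : Fin n → V → ℝ) (v : NodeSpace n V) : ℝ := ∑ i, q i (v i)

/-- The vector fields `gm i`, on `n`-tuples. -/
def nodeField (gm : Fin n → V → V) (v : NodeSpace n V) : NodeSpace n V :=
  WithLp.toLp 2 (fun i => gm i (v i))

theorem inner_nodeConst (x : V) (v : NodeSpace n V) :
    inner ℝ (nodeConst n x) v = inner ℝ x (∑ i, v i) := by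
  rw [NodeSpace.inner_eq, inner_sum]
  rfl

namespace NodeProblem

variable {q : Fin n → V → ℝ} {gm : Fin n → V → V} {xs : V} {L : ℝ}

theorem nonneg (h : NodeProblem q gm xs L) (hn : 0 < n) : 0 ≤ L :=
  (norm_nonneg _).trans (h.norm_le ⟨0, hn⟩ 0)

/-- Compare x* with the midpoint of x and x*: convexity and q_i(x*) = 0 halve the sum of the q_i,
and the parallelogram law produces the quadratic term. -/
theorem quadratic_growth (h : NodeProblem q gm xs L) (x : V) :
    1 / 4 * ‖x - xs‖ ^ 2 ≤ 1 / (n : ℝ) * ∑ i, q i x + 1 / 2 * ‖x‖ ^ 2 - 1 / 2 * ‖xs‖ ^ 2 := by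
  have h1 := h.optimal ((1 / 2 : ℝ) • x + (1 / 2 : ℝ) • xs)
  have h2 : ∑ i, q i ((1 / 2 : ℝ) • x + (1 / 2 : ℝ) • xs) ≤ 1 / 2 * ∑ i, q i x := by
    rw [Finset.mul_sum]
    refine Finset.sum_le_sum fun i _ => ?_
    have := (h.convex i).2 (mem_univ x) (mem_univ xs) (by norm_num : (0 : ℝ) ≤ 1 / 2)
      (by norm_num : (0 : ℝ) ≤ 1 / 2) (by norm_num)
    simpa [h.zero i] using this
  have h3 : ‖(1 / 2 : ℝ) • x + (1 / 2 : ℝ) • xs‖ ^ 2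
      = 1 / 2 * ‖x‖ ^ 2 + 1 / 2 * ‖xs‖ ^ 2 - 1 / 4 * ‖x - xs‖ ^ 2 := by
    simp only [← real_inner_self_eq_norm_sq, inner_add_left, inner_sub_left, inner_add_right,
      inner_sub_right, real_inner_smul_right, real_inner_comm]
    ring
  have h4 := mul_le_mul_of_nonneg_left h2 (by positivity : 0 ≤ 1 / (n : ℝ))
  rw [h3] at h1
  linarith

/-- Quadratic growth at the origin against the Lipschitz bound gives (3/4)‖x*‖² ≤ L‖x*‖. This
removes ‖x*‖ from the final rate, since the algorithm starts at zero. -/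
theorem norm_sq_le (h : NodeProblem q gm xs L) (hn : 0 < n) : ‖xs‖ ^ 2 ≤ 16 / 9 * L ^ 2 := by
  have hn0 : (0 : ℝ) < n := by exact_mod_cast hn
  have h1 := h.quadratic_growth 0
  have h2 : ∑ i, q i 0 ≤ n * (L * ‖xs‖) := by
    have : ∀ i ∈ (Finset.univ : Finset (Fin n)), q i 0 ≤ L * ‖xs‖ := fun i _ => by
      simpa [h.zero i] using h.lipschitz i xs 0
    simpa using Finset.sum_le_sum this
  have h3 : 1 / (n : ℝ) * ∑ i, q i 0 ≤ L * ‖xs‖ := by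
    refine (mul_le_mul_of_nonneg_left h2 (by positivity)).trans_eq ?_
    field_simp
  simp only [zero_sub, norm_neg, norm_zero] at h1
  have h4 : 3 / 4 * ‖xs‖ ^ 2 ≤ L * ‖xs‖ := by linarith
  nlinarith [sq_nonneg (3 / 2 * ‖xs‖ - 2 * L), sq_nonneg (3 / 4 * ‖xs‖ - L), h.nonneg hn]

theorem convex_nodeSum (h : NodeProblem q gm xs L) : ConvexOn ℝ univ (nodeSum q) := by
  refine ⟨convex_univ, fun x _ y _ a b ha hb hab => ?_⟩
  simp only [nodeSum, smul_eq_mul, Finset.mul_sum, ← Finset.sum_add_distrib]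
  exact Finset.sum_le_sum fun i _ => (h.convex i).2 (mem_univ _) (mem_univ _) ha hb hab

theorem lipschitz_nodeSum (h : NodeProblem q gm xs L) (hn : 0 < n) (u u' : NodeSpace n V) :
    nodeSum q u' - nodeSum q u ≤ L * Real.sqrt n * ‖u' - u‖ := by
  have h1 : nodeSum q u' - nodeSum q u ≤ L * ∑ i, ‖(u' - u) i‖ := by
    rw [nodeSum, nodeSum, ← Finset.sum_sub_distrib, Finset.mul_sum]
    exact Finset.sum_le_sum fun i _ => h.lipschitz i (u i) (u' i)
  rw [mul_assoc]
  exact h1.trans (mul_le_mul_of_nonneg_left (NodeSpace.sum_norm_le _) (h.nonneg hn))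

theorem nodeSum_le_inner (h : NodeProblem q gm xs L) (u : NodeSpace n V) :
    nodeSum q u ≤ inner ℝ (nodeField gm u) (u - nodeConst n xs) := by
  rw [NodeSpace.inner_eq]
  exact Finset.sum_le_sum fun i _ => h.le_inner i (u i)

theorem norm_nodeField_le (h : NodeProblem q gm xs L) (hn : 0 < n) (u : NodeSpace n V) :
    ‖nodeField gm u‖ ≤ L * Real.sqrt n := by
  have hL := h.nonneg hn
  refine le_of_sq_le_sq ?_ (by positivity)
  rw [mul_pow, Real.sq_sqrt (Nat.cast_nonneg n), PiLp.norm_sq_eq_of_L2]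
  have : ∀ i ∈ (Finset.univ : Finset (Fin n)), ‖nodeField gm u i‖ ^ 2 ≤ L ^ 2 := fun i _ =>
    pow_le_pow_left₀ (norm_nonneg _) (h.norm_le i (u i)) 2
  refine (Finset.sum_le_sum this).trans_eq ?_
  simp [mul_comm]

/-- A lower bound of the Lagrangian gap at dual points `(y, z)` with `z` of sum zero. -/
theorem le_lagrangianGap (hn : 0 < n)
    (Q : NodeSpace n V → ℝ) (xs : V) (yc zc x y z : NodeSpace n V)
    (hz : consensusProj n V z = z) :
    Q x + 1 / 3 * ‖x‖ ^ 2 - inner ℝ yc x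
      - (1 / 2 * ‖nodeConst n xs‖ ^ 2 + 3 / 2 * ‖yc + zc‖ ^ 2)
      ≤ lagrangianGap Q (nodeConst n xs) yc zc x y z := by
  have h1 : inner ℝ z (nodeConst n xs) = 0 := by
    rw [real_inner_comm, inner_nodeConst, ← hz, sum_consensusProj hn, inner_zero_right]
  have h2 : 0 ≤ ‖y + z + (1 / 3 : ℝ) • nodeConst n xs‖ ^ 2 := sq_nonneg _
  have h3 : ‖y + z + (1 / 3 : ℝ) • nodeConst n xs‖ ^ 2
      = ‖y + z‖ ^ 2 + 2 / 3 * (inner ℝ y (nodeConst n xs) + inner ℝ z (nodeConst n xs))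
        + 1 / 9 * ‖nodeConst n xs‖ ^ 2 := by
    rw [norm_add_sq_real, real_inner_smul_right, inner_add_left, norm_smul, mul_pow]
    norm_num
    ring
  unfold lagrangianGap
  linarith

/-- The gap at the average `xo` of the entries of `xa` in terms of the Lagrangian, for suitable
dual comparison points. -/
theorem exists_dual_comparison {W : NodeSpace n V →ₗ[ℝ] NodeSpace n V} {χ : ℝ}
    (hW : IsGossipOperator (consensusProj n V) W χ) (h : NodeProblem q gm xs L) (hn : 0 < n)
    (xa : NodeSpace n V) {xo : V} (hxo : xo = (1 / (n : ℝ)) • ∑ i, xa i) :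
    ∃ yc zc : NodeSpace n V, consensusProj n V zc = zc ∧ ‖zc‖ ^ 2 ≤ n * L ^ 2 ∧
      ‖yc‖ ^ 2 ≤ n * (2 / 9 * ‖xs‖ ^ 2 + 2 * L ^ 2) ∧
      n * (1 / (n : ℝ) * ∑ i, q i xo + 1 / 2 * ‖xo‖ ^ 2 - 1 / 2 * ‖xs‖ ^ 2
        - 1 / 6 * ‖xo - xs‖ ^ 2)
      ≤ nodeSum q xa + 1 / 3 * ‖xa‖ ^ 2 - inner ℝ yc xa
        - (1 / 2 * ‖nodeConst n xs‖ ^ 2 + 3 / 2 * ‖yc + zc‖ ^ 2) := by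
  have hn0 : (0 : ℝ) < n := by exact_mod_cast hn
  have hL := h.nonneg hn
  set pv := consensusProj n V xa with hpv
  set c := L * Real.sqrt n / ‖pv‖ with hc
  have hPpv : consensusProj n V pv = pv := hW.idem xa
  have hcn : ‖c • pv‖ ^ 2 ≤ n * L ^ 2 := by
    have : ‖c • pv‖ ≤ L * Real.sqrt n := by
      rw [norm_smul, hc, Real.norm_of_nonneg (by positivity)]
      rcases eq_or_ne ‖pv‖ 0 with h0 | h0
      · rw [h0, mul_zero]
        positivity
      · rw [div_mul_cancel₀ _ h0]
    refine (pow_le_pow_left₀ (norm_nonneg _) this 2).trans_eq ?_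
    rw [mul_pow, Real.sq_sqrt (Nat.cast_nonneg n), mul_comm]
  have hsum : ∑ i, xa i = (n : ℝ) • xo := by
    rw [hxo, smul_smul, mul_one_div_cancel hn0.ne', one_smul]
  have hxa : xa = nodeConst n xo + pv := by
    ext i
    simp [hpv, nodeConst, hxo]
  -- The multiplier zc points along the disagreement of `xa` with norm L√n (or is zero), so it acts
  -- as an exact penalty that pays for replacing `xa` by its average. Then yc is set so that yc + zc
  -- = -x*/3, the optimal value at x* rather than at xo. This keeps yc bounded by data independent
  -- of the output, at the cost of ‖xo - x*‖²/6.
  refine ⟨-((1 / 3 : ℝ) • nodeConst n xs) - c • pv, c • pv, by rw [map_smul, hPpv], hcn, ?_, ?_⟩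
  · have h1 : ‖-((1 / 3 : ℝ) • nodeConst n xs) - c • pv‖ ^ 2
        ≤ 2 * (‖(1 / 3 : ℝ) • nodeConst n xs‖ ^ 2 + ‖c • pv‖ ^ 2) := by
      have e := norm_sub_le (-((1 / 3 : ℝ) • nodeConst n xs)) (c • pv)
      rw [norm_neg] at e
      have := pow_le_pow_left₀ (norm_nonneg _) e 2
      nlinarith [sq_nonneg (‖(1 / 3 : ℝ) • nodeConst n xs‖ - ‖c • pv‖)]
    have h2 : ‖(1 / 3 : ℝ) • nodeConst n xs‖ ^ 2 = 1 / 9 * (n * ‖xs‖ ^ 2) := by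
      rw [norm_smul, mul_pow, norm_nodeConst_sq]
      norm_num
    linarith
  · have hpx : inner ℝ pv xa = ‖pv‖ ^ 2 := by
      rw [← real_inner_self_eq_norm_sq, ← hPpv, hW.symm, hPpv]
    have hcpx : inner ℝ (c • pv) xa = L * Real.sqrt n * ‖pv‖ := by
      rw [real_inner_smul_left, hpx, hc]
      rcases eq_or_ne ‖pv‖ 0 with h0 | h0
      · simp [h0]
      · field_simp
    have hQ : nodeSum q (nodeConst n xo) - nodeSum q xa ≤ L * Real.sqrt n * ‖pv‖ := by
      have := h.lipschitz_nodeSum hn xa (nodeConst n xo)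
      have e : nodeConst n xo - xa = -pv := by rw [hxa]; abel
      rwa [e, norm_neg] at this
    have hQc : nodeSum q (nodeConst n xo) = ∑ i, q i xo := rfl
    have hin : inner ℝ (nodeConst n xs) xa = n * inner ℝ xs xo := by
      rw [inner_nodeConst, hsum, real_inner_smul_right]
    have hnx : n * ‖xo‖ ^ 2 ≤ ‖xa‖ ^ 2 := by
      have e : inner ℝ (nodeConst n xo) pv = 0 := by
        rw [inner_nodeConst, hpv, sum_consensusProj hn, inner_zero_right]
      have : ‖xa‖ ^ 2 = n * ‖xo‖ ^ 2 + ‖pv‖ ^ 2 := by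
        conv_lhs => rw [hxa]
        rw [norm_add_sq_real, e, norm_nodeConst_sq]
        ring
      nlinarith [sq_nonneg ‖pv‖]
    have hyz : -((1 / 3 : ℝ) • nodeConst n xs) - c • pv + c • pv
        = -((1 / 3 : ℝ) • nodeConst n xs) := by abel
    have hyz2 : ‖-((1 / 3 : ℝ) • nodeConst n xs)‖ ^ 2 = 1 / 9 * (n * ‖xs‖ ^ 2) := by
      rw [norm_neg, norm_smul, mul_pow, norm_nodeConst_sq]
      norm_num
    rw [hyz, hyz2, inner_sub_left, inner_neg_left, real_inner_smul_left, hcpx, hin,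
      norm_nodeConst_sq, norm_sub_sq_real, real_inner_comm xs xo]
    have e : n * (1 / (n : ℝ) * ∑ i, q i xo) = ∑ i, q i xo := by field_simp
    nlinarith

end NodeProblem

/-- The gap at the output of the algorithm, for every run. -/
theorem gap_algOutput_le {q : Fin n → V → ℝ} {gm : Fin n → V → V} {xs : V} {L : ℝ}
    (h : NodeProblem q gm xs L) (hn : 0 < n) {χ : ℝ} {K T : ℕ} (hK : 1 ≤ K) (hT : 1 ≤ T)
    {W : ℕ → Matrix (Fin n) (Fin n) ℝ}
    (hW : ∀ k, IsGossipOperator (consensusProj n V) (gossipMap V (W k)) χ)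
    (g : ℕ → ℕ → Fin n → V → V) :
    let P := stdParams 1 χ K T
    let u : ℕ → ℕ → NodeSpace n V := fun k t => WithLp.toLp 2 (innerPoint P T W g k t)
    let δ : ℕ → ℕ → NodeSpace n V := fun k t =>
      WithLp.toLp 2 (fun i => g k t i (u k t i)) - nodeField gm (u k t)
    let xo := algOutput P K T 0 0 0 0 W g
    1 / (n : ℝ) * ∑ i, q i xo + 1 / 2 * ‖xo‖ ^ 2 - 1 / 2 * ‖xs‖ ^ 2
      ≤ 27 / (K : ℝ) ^ 2 * (30 * χ ^ 2 * L ^ 2 + 1 / (n : ℝ) * ∑ k ∈ Finset.range K,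
          1 / P.α k * oracleError (L * Real.sqrt n) (P.ηx k) T (nodeConst n xs) (δ k) (u k)) := by
  intro P u δ xo
  have hn0 : (0 : ℝ) < n := by exact_mod_cast hn
  have hK0 : (0 : ℝ) < K := by exact_mod_cast hK
  set s := algState P T 0 0 0 0 W g with hs
  set Λ := ∑ k ∈ Finset.Icc 1 K, P.lam k with hΛ
  have hΛK : (K : ℝ) ^ 2 / 9 ≤ Λ := le_sum_lam χ T hK
  have hΛ0 : 0 < Λ := lt_of_lt_of_le (by positivity) hΛK
  set xa : NodeSpace n V :=
    (Finset.Icc 1 K).centerMass P.lam (fun k => WithLp.toLp 2 (s k).xBar) with hxa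
  have hxo : xo = (1 / (n : ℝ)) • ∑ i, xa i := by
    have : xa = WithLp.toLp 2 ((∑ k ∈ Finset.Icc 1 K, P.lam k)⁻¹ •
        ∑ k ∈ Finset.Icc 1 K, P.lam k • (s k).xBar) := by
      rw [WithLp.toLp_smul, WithLp.toLp_sum]
      rfl
    rw [this]
    rfl
  -- The comparison points depend on the output of this very run. This is legitimate because the
  -- summed inequality holds for all of them on each path.
  obtain ⟨yc, zc, hPzc, hzc, hyc, hgap⟩ := h.exists_dual_comparison (hW 0) hn xa hxo
  have hsum := sum_lam_lagrangianGap_le (K := K) hK hT hW h.convex_nodeSum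
    (h.lipschitz_nodeSum hn) h.nodeSum_le_inner (h.norm_nodeField_le hn) g yc zc hPzc
  set err := ∑ k ∈ Finset.range K,
    1 / P.α k * oracleError (L * Real.sqrt n) (P.ηx k) T (nodeConst n xs) (δ k) (u k) with herr
  set c := 1 / 2 * ‖nodeConst n xs‖ ^ 2 + 3 / 2 * ‖yc + zc‖ ^ 2 with hc
  -- The dual iterates are eliminated by `le_lagrangianGap`, so this bound depends on x alone and
  -- Jensen's inequality applies at the weighted mean.
  set H : NodeSpace n V → ℝ := fun x => nodeSum q x + 1 / 3 * ‖x‖ ^ 2 - inner ℝ yc x - c with hH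
  have hHc : ConvexOn ℝ univ H := by
    have h1 : ConvexOn ℝ univ (fun w : NodeSpace n V => ‖w‖ ^ 2) := by
      simpa using convexOn_norm_sub_sq (0 : NodeSpace n V)
    have h2 : ConvexOn ℝ univ (fun w : NodeSpace n V => -inner ℝ yc w) :=
      ((-(innerₛₗ ℝ yc)).convexOn convex_univ)
    have := (((h.convex_nodeSum).add (h1.smul (by norm_num : (0 : ℝ) ≤ 1 / 3))).add h2).add_const
      (-c)
    refine this.congr fun w _ => ?_
    simp only [hH, Pi.add_apply, smul_eq_mul]
    ring
  have hJ : Λ * H xa ≤ ∑ k ∈ Finset.Icc 1 K, P.lam k * H (WithLp.toLp 2 (s k).xBar) := by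
    have := hHc.map_centerMass_le (t := Finset.Icc 1 K) (w := P.lam)
      (p := fun k => WithLp.toLp 2 (s k).xBar)
      (fun k hk => lam_nonneg χ K T (Finset.mem_Icc.1 hk).1) hΛ0 (fun _ _ => mem_univ _)
    have e : (Finset.Icc 1 K).centerMass P.lam (H ∘ fun k => WithLp.toLp 2 (s k).xBar)
        = Λ⁻¹ * ∑ k ∈ Finset.Icc 1 K, P.lam k * H (WithLp.toLp 2 (s k).xBar) := rfl
    rw [e] at this
    exact (le_inv_mul_iff₀ hΛ0).1 this
  have hlow : ∑ k ∈ Finset.Icc 1 K, P.lam k * H (WithLp.toLp 2 (s k).xBar)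
      ≤ ∑ k ∈ Finset.Icc 1 K, P.lam k * lagrangianGap (nodeSum q) (nodeConst n xs) yc zc
        (WithLp.toLp 2 (s k).xBar) (WithLp.toLp 2 (s k).yBar) (WithLp.toLp 2 (s k).zBar) :=
    Finset.sum_le_sum fun k hk => mul_le_mul_of_nonneg_left
      (NodeProblem.le_lagrangianGap hn _ xs yc zc _ _ _ (consensusProj_state hW P T g k).2)
      (lam_nonneg χ K T (Finset.mem_Icc.1 hk).1)
  set G := 1 / (n : ℝ) * ∑ i, q i xo + 1 / 2 * ‖xo‖ ^ 2 - 1 / 2 * ‖xs‖ ^ 2 with hG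
  have hqg := h.quadratic_growth xo
  -- Quadratic growth with constant 1/4 absorbs the loss of 1/6 and leaves a third of the gap.
  have hG3 : 1 / 3 * G ≤ G - 1 / 6 * ‖xo - xs‖ ^ 2 := by linarith
  have hG0 : 0 ≤ G := le_trans (by positivity) hqg
  have hxs := h.norm_sq_le hn
  have hχ := (hW 0).one_le
  have hB : 1 / 3 * ‖nodeConst n xs‖ ^ 2 + 6 * ‖yc‖ ^ 2 + 15 * χ ^ 2 * ‖zc‖ ^ 2
      ≤ n * (30 * χ ^ 2 * L ^ 2) := by
    have h1 := mul_le_mul_of_nonneg_left hzc (by positivity : 0 ≤ 15 * χ ^ 2)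
    rw [norm_nodeConst_sq]
    have h2 : 1 / 3 * (n * ‖xs‖ ^ 2) + 6 * ‖yc‖ ^ 2 ≤ n * (15 * L ^ 2) := by
      have := mul_le_mul_of_nonneg_left hxs hn0.le
      have := mul_nonneg hn0.le (sq_nonneg L)
      linarith
    have h3 : n * (15 * L ^ 2) ≤ n * (15 * χ ^ 2 * L ^ 2) := by
      refine mul_le_mul_of_nonneg_left ?_ hn0.le
      refine mul_le_mul_of_nonneg_right ?_ (sq_nonneg L)
      nlinarith
    linarith
  have hall : Λ * (n * (1 / 3 * G)) ≤ n * (30 * χ ^ 2 * L ^ 2) + err := by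
    have h1 := mul_le_mul_of_nonneg_left
      ((mul_le_mul_of_nonneg_left hG3 hn0.le).trans hgap) hΛ0.le
    have h2 := h1.trans (hJ.trans (hlow.trans hsum))
    linarith
  have hfin : (K : ℝ) ^ 2 / 9 * (n * (1 / 3 * G)) ≤ n * (30 * χ ^ 2 * L ^ 2) + err :=
    (mul_le_mul_of_nonneg_right hΛK (by positivity)).trans hall
  -- 27 is 9 from the total weight times 3 from the retained third of the gap.
  have e1 : G = 27 / (K : ℝ) ^ 2 * (1 / n * ((K : ℝ) ^ 2 / 9 * (n * (1 / 3 * G)))) := by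
    field_simp
    ring
  rw [e1]
  refine mul_le_mul_of_nonneg_left ?_ (by positivity)
  refine (mul_le_mul_of_nonneg_left hfin (by positivity)).trans_eq ?_
  field_simp

end Network

set_option linter.unusedSectionVars false

/-! ### One oracle call at an independent random point -/

section SingleCall

variable {V : Type*} [NormedAddCommGroup V] [InnerProductSpace ℝ V] [FiniteDimensional ℝ V]
  [MeasurableSpace V] [BorelSpace V] {S : Type*} [MeasurableSpace S]

/-- A stochastic oracle for the vector field `gm`, with variance at most `σ²`. -/
structure UnbiasedOracle (D : Measure S) (gt : S → V → V) (gm : V → V) (σ : ℝ) : Prop where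
  measurable : Measurable (fun p : S × V => gt p.1 p.2)
  memLp : ∀ x, MemLp (fun s => gt s x) 2 D
  mean : ∀ x, ∫ s, gt s x ∂D = gm x
  variance_le : ∀ x, ∫ s, ‖gt s x - gm x‖ ^ 2 ∂D ≤ σ ^ 2

namespace UnbiasedOracle

variable {D : Measure S} [IsProbabilityMeasure D] {gt : S → V → V} {gm : V → V} {σ : ℝ}

theorem measurable_mean (h : UnbiasedOracle D gt gm σ) : Measurable gm := by
  have h1 : StronglyMeasurable (fun p : V × S => gt p.2 p.1) :=
    (h.measurable.comp measurable_swap).stronglyMeasurable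
  have h2 : StronglyMeasurable (fun x => ∫ s, gt s x ∂D) := h1.integral_prod_right
  have e : (fun x => ∫ s, gt s x ∂D) = gm := funext h.mean
  rw [e] at h2
  exact h2.measurable

theorem memLp_sub (h : UnbiasedOracle D gt gm σ) (x : V) :
    MemLp (fun s => gt s x - gm x) 2 D :=
  (h.memLp x).sub (memLp_const _)

theorem integral_sub_eq_zero (h : UnbiasedOracle D gt gm σ) (x : V) :
    ∫ s, (gt s x - gm x) ∂D = 0 := by
  rw [integral_sub ((h.memLp x).integrable one_le_two) (integrable_const _), h.mean]
  simp

/-- Tonelli: the inner integral over the samples is bounded by σ² uniformly in the point, so no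
moment of the law of the point is needed. -/
theorem integrable_sq_prod (h : UnbiasedOracle D gt gm σ) (ν : Measure V)
    [IsProbabilityMeasure ν] :
    Integrable (fun p : S × V => ‖gt p.1 p.2 - gm p.2‖ ^ 2) (D.prod ν) := by
  have hm : Measurable (fun p : S × V => ‖gt p.1 p.2 - gm p.2‖ ^ 2) :=
    ((h.measurable.sub (h.measurable_mean.comp measurable_snd)).norm).pow_const 2
  rw [integrable_prod_iff' hm.aestronglyMeasurable]
  refine ⟨Filter.Eventually.of_forall fun x => (h.memLp_sub x).integrable_norm_pow two_ne_zero, ?_⟩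
  refine Integrable.of_bound (C := σ ^ 2) ?_ (Filter.Eventually.of_forall fun x => ?_)
  · exact ((hm.norm.comp measurable_swap).stronglyMeasurable.integral_prod_right
      (f := fun (x : V) (s : S) => ‖‖gt s x - gm x‖ ^ 2‖)).aestronglyMeasurable
  · rw [Real.norm_of_nonneg (integral_nonneg fun _ => norm_nonneg _)]
    refine le_trans (le_of_eq ?_) (h.variance_le x)
    refine integral_congr_ae (Filter.Eventually.of_forall fun s => ?_)
    simp

variable {Ω : Type*} [MeasurableSpace Ω] {μ : Measure Ω} [IsProbabilityMeasure μ]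
  {Y : Ω → S} {X : Ω → V}

theorem map_prod_eq (hY : Measurable Y) (hX : Measurable X) (hD : μ.map Y = D)
    (hind : IndepFun Y X μ) : μ.map (fun ω => (Y ω, X ω)) = D.prod (μ.map X) := by
  rw [(indepFun_iff_map_prod_eq_prod_map_map hY.aemeasurable hX.aemeasurable).1 hind, hD]

theorem integrable_noise_sq (h : UnbiasedOracle D gt gm σ) (hY : Measurable Y)
    (hX : Measurable X) (hD : μ.map Y = D) (hind : IndepFun Y X μ) :
    Integrable (fun ω => ‖gt (Y ω) (X ω) - gm (X ω)‖ ^ 2) μ := by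
  have := Measure.isProbabilityMeasure_map (μ := μ) hX.aemeasurable
  have h1 := h.integrable_sq_prod (μ.map X)
  rw [← map_prod_eq hY hX hD hind] at h1
  exact h1.comp_measurable (hY.prodMk hX)

theorem integral_noise_sq_le (h : UnbiasedOracle D gt gm σ) (hY : Measurable Y)
    (hX : Measurable X) (hD : μ.map Y = D) (hind : IndepFun Y X μ) :
    ∫ ω, ‖gt (Y ω) (X ω) - gm (X ω)‖ ^ 2 ∂μ ≤ σ ^ 2 := by
  have := Measure.isProbabilityMeasure_map (μ := μ) hX.aemeasurable
  have h1 := h.integrable_sq_prod (μ.map X)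
  have e := map_prod_eq hY hX hD hind
  have h2 : ∫ ω, ‖gt (Y ω) (X ω) - gm (X ω)‖ ^ 2 ∂μ
      = ∫ p, ‖gt p.1 p.2 - gm p.2‖ ^ 2 ∂(D.prod (μ.map X)) := by
    rw [← e] at h1 ⊢
    rw [integral_map (hY.prodMk hX).aemeasurable h1.aestronglyMeasurable]
  rw [h2, integral_prod_symm _ h1]
  calc ∫ x, ∫ s, ‖gt s x - gm x‖ ^ 2 ∂D ∂(μ.map X) ≤ ∫ _, σ ^ 2 ∂(μ.map X) :=
        integral_mono h1.integral_prod_right (integrable_const _) h.variance_le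
    _ = σ ^ 2 := by simp

theorem memLp_noise (h : UnbiasedOracle D gt gm σ) (hY : Measurable Y)
    (hX : Measurable X) (hD : μ.map Y = D) (hind : IndepFun Y X μ) :
    MemLp (fun ω => gt (Y ω) (X ω) - gm (X ω)) 2 μ := by
  have hm : Measurable (fun ω => gt (Y ω) (X ω) - gm (X ω)) :=
    (h.measurable.comp (hY.prodMk hX)).sub (h.measurable_mean.comp hX)
  rw [← memLp_norm_iff hm.aestronglyMeasurable,
    memLp_two_iff_integrable_sq hm.norm.aestronglyMeasurable]
  exact h.integrable_noise_sq hY hX hD hind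

theorem memLp_call (h : UnbiasedOracle D gt gm σ) {L : ℝ} (hL : ∀ x, ‖gm x‖ ≤ L)
    (hY : Measurable Y) (hX : Measurable X) (hD : μ.map Y = D) (hind : IndepFun Y X μ) :
    MemLp (fun ω => gt (Y ω) (X ω)) 2 μ := by
  have h1 : MemLp (fun ω => gm (X ω)) 2 μ :=
    MemLp.of_bound (h.measurable_mean.comp hX).aestronglyMeasurable L
      (Filter.Eventually.of_forall fun ω => hL _)
  have := (h.memLp_noise hY hX hD hind).add h1
  refine this.ae_eq (Filter.Eventually.of_forall fun ω => ?_)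
  simp

theorem integrable_inner_of_memLp {f g : Ω → V} (hf : MemLp f 2 μ) (hg : MemLp g 2 μ) :
    Integrable (fun ω => inner ℝ (f ω) (g ω)) μ := by
  refine (hf.norm.integrable_mul hg.norm).mono'
    (hf.aestronglyMeasurable.inner hg.aestronglyMeasurable)
    (Filter.Eventually.of_forall fun ω => ?_)
  exact norm_inner_le_norm _ _

/-- By independence the joint law is a product; for a fixed point the noise has mean zero, so Fubini
gives zero. Square-integrability of X is needed only to make the inner product integrable. -/
theorem integral_inner_noise (h : UnbiasedOracle D gt gm σ) (hY : Measurable Y)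
    (hX : Measurable X) (hD : μ.map Y = D) (hind : IndepFun Y X μ) (hX2 : MemLp X 2 μ) (xs : V) :
    ∫ ω, inner ℝ (gt (Y ω) (X ω) - gm (X ω)) (xs - X ω) ∂μ = 0 := by
  have e := map_prod_eq hY hX hD hind
  have hm : Measurable (fun p : S × V => inner ℝ (gt p.1 p.2 - gm p.2) (xs - p.2)) :=
    (h.measurable.sub (h.measurable_mean.comp measurable_snd)).inner
      (measurable_const.sub measurable_snd)
  have hint : Integrable (fun p : S × V => inner ℝ (gt p.1 p.2 - gm p.2) (xs - p.2))
      (D.prod (μ.map X)) := by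
    rw [← e, integrable_map_measure hm.aestronglyMeasurable (hY.prodMk hX).aemeasurable]
    exact integrable_inner_of_memLp (h.memLp_noise hY hX hD hind) ((memLp_const xs).sub hX2)
  have h2 : ∫ ω, inner ℝ (gt (Y ω) (X ω) - gm (X ω)) (xs - X ω) ∂μ
      = ∫ p, inner ℝ (gt p.1 p.2 - gm p.2) (xs - p.2) ∂(D.prod (μ.map X)) := by
    rw [← e, integral_map (hY.prodMk hX).aemeasurable hm.aestronglyMeasurable]
  have := Measure.isProbabilityMeasure_map (μ := μ) hX.aemeasurable
  rw [h2, integral_prod_symm _ hint]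
  have h3 : ∀ x, ∫ s, inner ℝ (gt s x - gm x) (xs - x) ∂D = 0 := by
    intro x
    have h4 : ∫ s, inner ℝ (xs - x) (gt s x - gm x) ∂D = 0 := by
      rw [integral_inner ((h.memLp_sub x).integrable one_le_two), h.integral_sub_eq_zero,
        inner_zero_right]
    rw [← h4]
    exact integral_congr_ae (Filter.Eventually.of_forall fun s => real_inner_comm _ _)
  simp [h3]

end UnbiasedOracle

end SingleCall

set_option linter.unusedSectionVars false

/-! ### Measurability along a run and the expected gap -/

section Run

variable {n : ℕ} {V : Type*} [NormedAddCommGroup V] [InnerProductSpace ℝ V]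
  [FiniteDimensional ℝ V] [MeasurableSpace V] [BorelSpace V] {S : Type*} [MeasurableSpace S]
  {Ω : Type*} {mΩ : MeasurableSpace Ω}

/-- The square-integrable random tuples that are measurable with respect to `m`. -/
def adaptedL2 (n : ℕ) (V : Type*) [NormedAddCommGroup V] [InnerProductSpace ℝ V]
    [FiniteDimensional ℝ V] [MeasurableSpace V] [BorelSpace V] {mΩ : MeasurableSpace Ω}
    (μ : Measure Ω) [IsFiniteMeasure μ] (m : MeasurableSpace Ω) : Submodule ℝ (Ω → Fin n → V) where
  carrier := {X | ∀ i, Measurable[m] (fun ω => X ω i) ∧ MemLp (fun ω => X ω i) 2 μ}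
  add_mem' hX hY i := ⟨(hX i).1.add (hY i).1, (hX i).2.add (hY i).2⟩
  zero_mem' _ := ⟨measurable_const, memLp_const 0⟩
  smul_mem' c _ hX i := ⟨(hX i).1.const_smul c, (hX i).2.const_smul c⟩

theorem adaptedL2_mono {μ : Measure Ω} [IsFiniteMeasure μ] {m m' : MeasurableSpace Ω} (h : m ≤ m') :
    adaptedL2 n V μ m ≤ adaptedL2 n V μ m' :=
  fun _ hX i => ⟨(hX i).1.mono h le_rfl, (hX i).2⟩

theorem gossip_mem_adaptedL2 {μ : Measure Ω} [IsFiniteMeasure μ] {m : MeasurableSpace Ω}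
    (W : Matrix (Fin n) (Fin n) ℝ) {X : Ω → Fin n → V} (hX : X ∈ adaptedL2 n V μ m) :
    (fun ω => gossip W (X ω)) ∈ adaptedL2 n V μ m := by
  intro i
  refine ⟨?_, ?_⟩
  · exact Finset.measurable_sum _ fun j _ => (hX j).1.const_smul (W i j)
  · exact memLp_finsetSum _ fun j _ => (hX j).2.const_smul (W i j)

/-- All variables of a random state are adapted and square-integrable. -/
structure AdaptedState (μ : Measure Ω) [IsFiniteMeasure μ] (m : MeasurableSpace Ω)
    (s : Ω → AlgState n V) : Prop where
  x : (fun ω => (s ω).x) ∈ adaptedL2 n V μ m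
  xPrev : (fun ω => (s ω).xPrev) ∈ adaptedL2 n V μ m
  xTilde : (fun ω => (s ω).xTilde) ∈ adaptedL2 n V μ m
  xBar : (fun ω => (s ω).xBar) ∈ adaptedL2 n V μ m
  y : (fun ω => (s ω).y) ∈ adaptedL2 n V μ m
  yBar : (fun ω => (s ω).yBar) ∈ adaptedL2 n V μ m
  z : (fun ω => (s ω).z) ∈ adaptedL2 n V μ m
  zBar : (fun ω => (s ω).zBar) ∈ adaptedL2 n V μ m
  m : (fun ω => (s ω).m) ∈ adaptedL2 n V μ m

/-- The sigma-algebra of the samples used before step `(k, t)`. -/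
abbrev pastSamples (sample : ℕ × ℕ → Ω → S) (k t : ℕ) : MeasurableSpace Ω :=
  ⨆ p ∈ {p : ℕ × ℕ | p.1 < k ∨ p.1 = k ∧ p.2 < t},
    MeasurableSpace.comap (sample p) inferInstance

theorem pastSamples_mono (sample : ℕ × ℕ → Ω → S) {k t k' t' : ℕ}
    (h : k < k' ∨ k = k' ∧ t ≤ t') : pastSamples sample k t ≤ pastSamples sample k' t' := by
  refine biSup_mono fun p hp => ?_
  simp only [mem_ofPred_eq] at hp ⊢
  omega

theorem measurable_sample_pastSamples (sample : ℕ × ℕ → Ω → S) (k t : ℕ) :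
    Measurable[pastSamples sample k (t + 1)] (sample (k, t)) := by
  refine (comap_measurable (sample (k, t))).mono ?_ le_rfl
  exact le_biSup (fun p => MeasurableSpace.comap (sample p) inferInstance)
    (show (k, t) ∈ {p : ℕ × ℕ | p.1 < k ∨ p.1 = k ∧ p.2 < t + 1} by simp)

theorem pastSamples_le {sample : ℕ × ℕ → Ω → S} (hs : ∀ p, Measurable (sample p)) (k t : ℕ) :
    pastSamples sample k t ≤ mΩ :=
  iSup₂_le fun p _ => (hs p).comap_le

/-- The sigma-algebra of step (k, t) and that generated by the strictly earlier steps come from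
disjoint index sets. -/
theorem indepFun_sample_past {μ : Measure Ω} {sample : ℕ × ℕ → Ω → S}
    (hs : ∀ p, Measurable (sample p)) (hind : iIndepFun sample μ) {k t : ℕ} {X : Ω → V}
    (hX : Measurable[pastSamples sample k t] X) : IndepFun (sample (k, t)) X μ := by
  have h1 := indep_iSup_of_disjoint (fun p => (hs p).comap_le) hind
    (S := {(k, t)}) (T := {p : ℕ × ℕ | p.1 < k ∨ p.1 = k ∧ p.2 < t}) (by simp)
  rw [IndepFun_iff_Indep]
  refine indep_of_indep_of_le_left (indep_of_indep_of_le_right h1 hX.comap_le) ?_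
  simp

variable {μ : Measure Ω} [IsProbabilityMeasure μ] {D : Measure S} [IsProbabilityMeasure D]
  {gt : Fin n → S → V → V} {gm : Fin n → V → V} {σ L : ℝ} {sample : ℕ × ℕ → Ω → S}

theorem oracle_mem_adaptedL2 (h : ∀ i, UnbiasedOracle D (gt i) (gm i) σ)
    (hL : ∀ i x, ‖gm i x‖ ≤ L) (hs : ∀ p, Measurable (sample p)) (hD : ∀ p, μ.map (sample p) = D)
    (hind : iIndepFun sample μ) {k t : ℕ} {X : Ω → Fin n → V}
    (hX : X ∈ adaptedL2 n V μ (pastSamples sample k t)) :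
    (fun ω i => gt i (sample (k, t) ω) (X ω i)) ∈
      adaptedL2 n V μ (pastSamples sample k (t + 1)) := by
  intro i
  refine ⟨?_, ?_⟩
  · exact (h i).measurable.comp ((measurable_sample_pastSamples sample k t).prodMk
      ((hX i).1.mono (pastSamples_mono sample (Or.inr ⟨rfl, Nat.le_succ t⟩)) le_rfl))
  · exact (h i).memLp_call (hL i) (hs _) ((hX i).1.mono (pastSamples_le hs k t) le_rfl) (hD _)
      (indepFun_sample_past hs hind (hX i).1)

theorem innerIter_mem_adaptedL2 (h : ∀ i, UnbiasedOracle D (gt i) (gm i) σ)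
    (hL : ∀ i x, ‖gm i x‖ ≤ L) (hs : ∀ p, Measurable (sample p)) (hD : ∀ p, μ.map (sample p) = D)
    (hind : iIndepFun sample μ) (ηx β τx : ℝ) {k : ℕ} {xk y : Ω → Fin n → V}
    (hx : xk ∈ adaptedL2 n V μ (pastSamples sample k 0))
    (hy : y ∈ adaptedL2 n V μ (pastSamples sample k 0)) (t : ℕ) :
    (fun ω => innerIter ηx β τx (fun t i x => gt i (sample (k, t) ω) x) (xk ω) (y ω) t) ∈
      adaptedL2 n V μ (pastSamples sample k t) := by
  induction t with
  | zero => exact hx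
  | succ t ih =>
    have m0 : adaptedL2 n V μ (pastSamples sample k 0)
        ≤ adaptedL2 n V μ (pastSamples sample k (t + 1)) :=
      adaptedL2_mono (pastSamples_mono sample (Or.inr ⟨rfl, Nat.zero_le _⟩))
    have m1 : adaptedL2 n V μ (pastSamples sample k t)
        ≤ adaptedL2 n V μ (pastSamples sample k (t + 1)) :=
      adaptedL2_mono (pastSamples_mono sample (Or.inr ⟨rfl, Nat.le_succ t⟩))
    have hg := oracle_mem_adaptedL2 h hL hs hD hind ih
    exact Submodule.smul_mem _ _ (Submodule.sub_mem _ (m1 ih) (Submodule.smul_mem _ _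
      (Submodule.sub_mem _ (Submodule.sub_mem _ hg (m0 hy)) (Submodule.smul_mem _ _ (m0 hx)))))

/-- The algorithm run with the oracle answers for the sample path `ω`. -/
abbrev sampleOracle (gt : Fin n → S → V → V) (sample : ℕ × ℕ → Ω → S) (ω : Ω) :
    ℕ → ℕ → Fin n → V → V :=
  fun k t i x => gt i (sample (k, t) ω) x

/-- The new y uses no oracle answer of its own round, so it is known before the inner loop starts.
This keeps the inner iterates adapted. -/
theorem outerStep_y_mem {P : AlgParams} {T k : ℕ} {W : Matrix (Fin n) (Fin n) ℝ}
    {m : MeasurableSpace Ω} {g : Ω → ℕ → Fin n → V → V} {s : Ω → AlgState n V}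
    (hs : AdaptedState μ m s) :
    (fun ω => (outerStep P T k W (g ω) (s ω)).y) ∈ adaptedL2 n V μ m := by
  have hyU := Submodule.add_mem _ (Submodule.smul_mem _ (P.α k) hs.y)
    (Submodule.smul_mem _ (1 - P.α k) hs.yBar)
  have hzU := Submodule.add_mem _ (Submodule.smul_mem _ (P.α k) hs.z)
    (Submodule.smul_mem _ (1 - P.α k) hs.zBar)
  have hg := Submodule.smul_mem _ P.ryz (Submodule.add_mem _ hyU hzU)
  have hxh := Submodule.add_mem _ hs.x
    (Submodule.smul_mem _ (P.γ k) (Submodule.sub_mem _ hs.xTilde hs.xPrev))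
  exact Submodule.sub_mem _ hs.y (Submodule.smul_mem _ (P.ηy k) (Submodule.add_mem _ hg hxh))

theorem adaptedState_algState (h : ∀ i, UnbiasedOracle D (gt i) (gm i) σ)
    (hL : ∀ i x, ‖gm i x‖ ≤ L) (hs : ∀ p, Measurable (sample p)) (hD : ∀ p, μ.map (sample p) = D)
    (hind : iIndepFun sample μ) (P : AlgParams) (T : ℕ) (W : ℕ → Matrix (Fin n) (Fin n) ℝ)
    (k : ℕ) :
    AdaptedState μ (pastSamples sample k 0)
      (fun ω => algState P T 0 0 0 0 W (sampleOracle gt sample ω) k) := by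
  induction k with
  | zero =>
    exact ⟨zero_mem _, zero_mem _, zero_mem _, zero_mem _, zero_mem _, zero_mem _, zero_mem _,
      zero_mem _, zero_mem _⟩
  | succ k ih =>
    have hy := outerStep_y_mem (P := P) (T := T) (k := k) (W := W k)
      (g := fun ω => sampleOracle gt sample ω k) ih
    set I : ℕ → Ω → Fin n → V := fun t ω =>
      innerPoint P T W (sampleOracle gt sample ω) k t
    have hin : ∀ t, I t ∈ adaptedL2 n V μ (pastSamples sample (k + 1) 0) := fun t =>
      adaptedL2_mono (pastSamples_mono sample (Or.inl (Nat.lt_succ_self k)))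
        (innerIter_mem_adaptedL2 h hL hs hD hind (P.ηx k) (P.β k) (P.τx k) ih.x hy t)
    have m0 : adaptedL2 n V μ (pastSamples sample k 0)
        ≤ adaptedL2 n V μ (pastSamples sample (k + 1) 0) :=
      adaptedL2_mono (pastSamples_mono sample (Or.inl (Nat.lt_succ_self k)))
    have hyU := Submodule.add_mem _ (Submodule.smul_mem _ (P.α k) ih.y)
      (Submodule.smul_mem _ (1 - P.α k) ih.yBar)
    have hzU := Submodule.add_mem _ (Submodule.smul_mem _ (P.α k) ih.z)
      (Submodule.smul_mem _ (1 - P.α k) ih.zBar)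
    have hg := Submodule.smul_mem _ P.ryz (Submodule.add_mem _ hyU hzU)
    have hgt := gossip_mem_adaptedL2 (W k) hg
    have hgh := gossip_mem_adaptedL2 (W k) (Submodule.add_mem _ hg ih.m)
    have hxt : (fun ω => (1 / (T : ℝ)) • ∑ t ∈ Finset.Icc 1 T, I t ω) ∈
        adaptedL2 n V μ (pastSamples sample (k + 1) 0) := by
      convert Submodule.smul_mem _ (1 / (T : ℝ))
        (Submodule.sum_mem _ fun t (_ : t ∈ Finset.Icc 1 T) => hin t) using 1
      ext ω
      simp [Finset.sum_apply]
    refine ⟨?_, m0 ih.x, ?_, ?_, m0 hy, m0 ?_, m0 ?_, m0 ?_, m0 ?_⟩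
    · exact Submodule.add_mem _ (Submodule.smul_mem _ (P.σ k) (hin T))
        (Submodule.smul_mem _ (1 - P.σ k) hxt)
    · exact hxt
    · exact Submodule.add_mem _ (Submodule.smul_mem _ (P.α k) hxt)
        (Submodule.smul_mem _ (1 - P.α k) (m0 ih.xBar))
    · exact Submodule.add_mem _ hyU (Submodule.smul_mem _ (P.α k) (Submodule.sub_mem _ hy ih.y))
    · exact Submodule.sub_mem _ ih.z (Submodule.smul_mem _ (P.ηz k) hgh)
    · exact Submodule.sub_mem _ hzU (Submodule.smul_mem _ (P.θz k) hgt)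
    · exact Submodule.smul_mem _ (P.ηz k / P.ηz (k + 1))
        (Submodule.sub_mem _ (Submodule.add_mem _ ih.m hg) hgh)

theorem innerPoint_mem_adaptedL2 (h : ∀ i, UnbiasedOracle D (gt i) (gm i) σ)
    (hL : ∀ i x, ‖gm i x‖ ≤ L) (hs : ∀ p, Measurable (sample p)) (hD : ∀ p, μ.map (sample p) = D)
    (hind : iIndepFun sample μ) (P : AlgParams) (T : ℕ) (W : ℕ → Matrix (Fin n) (Fin n) ℝ)
    (k t : ℕ) :
    (fun ω => innerPoint P T W (sampleOracle gt sample ω) k t) ∈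
      adaptedL2 n V μ (pastSamples sample k t) :=
  innerIter_mem_adaptedL2 h hL hs hD hind (P.ηx k) (P.β k) (P.τx k)
    (adaptedState_algState h hL hs hD hind P T W k).x
    (outerStep_y_mem (g := fun ω => sampleOracle gt sample ω k)
      (adaptedState_algState h hL hs hD hind P T W k)) t

theorem measurable_algOutput (h : ∀ i, UnbiasedOracle D (gt i) (gm i) σ)
    (hL : ∀ i x, ‖gm i x‖ ≤ L) (hs : ∀ p, Measurable (sample p)) (hD : ∀ p, μ.map (sample p) = D)
    (hind : iIndepFun sample μ) (P : AlgParams) (K T : ℕ) (W : ℕ → Matrix (Fin n) (Fin n) ℝ) :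
    Measurable (fun ω => algOutput P K T 0 0 0 0 W (sampleOracle gt sample ω)) := by
  have hx : ∀ k i, Measurable
      (fun ω => (algState P T 0 0 0 0 W (sampleOracle gt sample ω) k).xBar i) := fun k i =>
    ((adaptedState_algState h hL hs hD hind P T W k).xBar i).1.mono (pastSamples_le hs k 0) le_rfl
  unfold algOutput
  simp only [Pi.smul_apply, Finset.sum_apply]
  exact (Finset.measurable_sum _ fun i _ =>
    (Finset.measurable_sum _ fun k _ => (hx k i).const_smul _).const_smul _).const_smul _

/-- A bound of the error of outer iteration `k` by sums over the nodes. -/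
theorem oracleError_le {L η : ℝ} (hη : 0 ≤ η) {T : ℕ} (xs : V) (δ u : ℕ → NodeSpace n V) :
    oracleError (L * Real.sqrt n) η T (nodeConst n xs) δ u ≤ 1 / (T : ℝ) *
      ∑ t ∈ Finset.range T, (∑ i, inner ℝ (δ t i) (xs - u t i)
        + η * (4 * L ^ 2 * n + ∑ i, ‖δ t i‖ ^ 2)) := by
  refine mul_le_mul_of_nonneg_left (Finset.sum_le_sum fun t _ => ?_) (by positivity)
  rw [NodeSpace.inner_eq, ← PiLp.norm_sq_eq_of_L2]
  refine add_le_add le_rfl ?_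
  have h1 : (2 * (L * Real.sqrt n) + ‖δ t‖) ^ 2 ≤ 2 * (4 * L ^ 2 * n + ‖δ t‖ ^ 2) := by
    have h2 : (2 * (L * Real.sqrt n)) ^ 2 = 4 * L ^ 2 * n := by
      rw [mul_pow, mul_pow, Real.sq_sqrt (Nat.cast_nonneg n)]
      ring
    rw [← h2]
    nlinarith [sq_nonneg (2 * (L * Real.sqrt n) - ‖δ t‖)]
  have := mul_le_mul_of_nonneg_left h1 (by positivity : 0 ≤ η / 2)
  linarith

/-- The expected gap at the output of the algorithm. -/
theorem integral_gap_algOutput_le {q : Fin n → V → ℝ} {xs : V} (hp : NodeProblem q gm xs L)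
    (hn : 0 < n) {χ : ℝ} {K T : ℕ} (hK : 1 ≤ K) (hT : 1 ≤ T)
    {W : ℕ → Matrix (Fin n) (Fin n) ℝ}
    (hW : ∀ k, IsGossipOperator (consensusProj n V) (gossipMap V (W k)) χ)
    (h : ∀ i, UnbiasedOracle D (gt i) (gm i) σ) (hσ : 0 ≤ σ)
    (hs : ∀ p, Measurable (sample p)) (hD : ∀ p, μ.map (sample p) = D)
    (hind : iIndepFun sample μ) :
    let xo : Ω → V := fun ω =>
      algOutput (stdParams 1 χ K T) K T 0 0 0 0 W (sampleOracle gt sample ω)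
    let gap : Ω → ℝ := fun ω =>
      1 / (n : ℝ) * ∑ i, q i (xo ω) + 1 / 2 * ‖xo ω‖ ^ 2 - 1 / 2 * ‖xs‖ ^ 2
    Integrable gap μ ∧ ∫ ω, gap ω ∂μ ≤
      810 * (χ ^ 2 * L ^ 2) / (K : ℝ) ^ 2 + 324 * (L + σ) ^ 2 / ((K : ℝ) * T) := by
  intro xo gap
  have hn0 : (0 : ℝ) < n := by exact_mod_cast hn
  have hK0 : (0 : ℝ) < K := by exact_mod_cast hK
  have hT0 : (0 : ℝ) < T := by exact_mod_cast hT
  have hL := hp.norm_le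
  have hL0 := hp.nonneg hn
  set P := stdParams 1 χ K T with hP
  have hα : ∀ k, 0 < P.α k := fun k => by
    change 0 < 3 / ((k : ℝ) + 3)
    positivity
  have hη : ∀ k, P.ηx k = 3 * P.α k / T := fun k => by
    change 1 / ((2 / 3 * 1 / 2) / P.α k * T) = _
    have := (hα k).ne'
    field_simp
  have hη0 : ∀ k, 0 ≤ P.ηx k := fun k => by
    rw [hη]
    have := hα k
    positivity
  set X : ℕ → ℕ → Ω → Fin n → V := fun k t ω =>
    innerPoint P T W (sampleOracle gt sample ω) k t with hX
  set Z : ℕ → ℕ → Fin n → Ω → V := fun k t i ω =>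
    gt i (sample (k, t) ω) (X k t ω i) - gm i (X k t ω i) with hZ
  have hXm : ∀ k t, X k t ∈ adaptedL2 n V μ (pastSamples sample k t) := fun k t =>
    innerPoint_mem_adaptedL2 h hL hs hD hind P T W k t
  have hXmeas : ∀ k t i, Measurable (fun ω => X k t ω i) := fun k t i =>
    (hXm k t i).1.mono (pastSamples_le hs k t) le_rfl
  have hXind : ∀ k t i, IndepFun (sample (k, t)) (fun ω => X k t ω i) μ := fun k t i =>
    indepFun_sample_past hs hind (hXm k t i).1
  have hZint : ∀ k t i, Integrable (fun ω => ‖Z k t i ω‖ ^ 2) μ := fun k t i =>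
    (h i).integrable_noise_sq (hs _) (hXmeas k t i) (hD _) (hXind k t i)
  have hZle : ∀ k t i, ∫ ω, ‖Z k t i ω‖ ^ 2 ∂μ ≤ σ ^ 2 := fun k t i =>
    (h i).integral_noise_sq_le (hs _) (hXmeas k t i) (hD _) (hXind k t i)
  have hIint : ∀ k t i, Integrable (fun ω => inner ℝ (Z k t i ω) (xs - X k t ω i)) μ :=
    fun k t i => UnbiasedOracle.integrable_inner_of_memLp
      ((h i).memLp_noise (hs _) (hXmeas k t i) (hD _) (hXind k t i))
      ((memLp_const xs).sub (hXm k t i).2)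
  have hIzero : ∀ k t i, ∫ ω, inner ℝ (Z k t i ω) (xs - X k t ω i) ∂μ = 0 := fun k t i =>
    (h i).integral_inner_noise (hs _) (hXmeas k t i) (hD _) (hXind k t i) (hXm k t i).2 xs
  set F : ℕ → ℕ → Ω → ℝ := fun k t ω => ∑ i, inner ℝ (Z k t i ω) (xs - X k t ω i)
    + P.ηx k * (4 * L ^ 2 * n + ∑ i, ‖Z k t i ω‖ ^ 2) with hF
  have hF1 : ∀ k t, Integrable (fun ω => ∑ i, inner ℝ (Z k t i ω) (xs - X k t ω i)) μ :=
    fun k t => integrable_finsetSum _ fun i _ => hIint k t i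
  have hF2 : ∀ k t, Integrable (fun ω => ∑ i, ‖Z k t i ω‖ ^ 2) μ :=
    fun k t => integrable_finsetSum _ fun i _ => hZint k t i
  have hF3 : ∀ k t, Integrable (fun ω => P.ηx k * (4 * L ^ 2 * n + ∑ i, ‖Z k t i ω‖ ^ 2)) μ :=
    fun k t => ((integrable_const _).add (hF2 k t)).const_mul _
  have hFint : ∀ k t, Integrable (F k t) μ := fun k t => (hF1 k t).add (hF3 k t)
  have hFle : ∀ k t, ∫ ω, F k t ω ∂μ ≤ P.ηx k * (n * (4 * L ^ 2 + σ ^ 2)) := by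
    intro k t
    have e : ∫ ω, F k t ω ∂μ
        = P.ηx k * (4 * L ^ 2 * n + ∑ i, ∫ ω, ‖Z k t i ω‖ ^ 2 ∂μ) := by
      simp only [hF]
      rw [integral_add (hF1 k t) (hF3 k t), integral_finsetSum _ fun i _ => hIint k t i,
        Finset.sum_eq_zero fun i _ => hIzero k t i, integral_const_mul,
        integral_add (integrable_const _) (hF2 k t), integral_finsetSum _ fun i _ => hZint k t i]
      simp
    rw [e]
    refine mul_le_mul_of_nonneg_left ?_ (hη0 k)
    have := Finset.sum_le_sum fun i (_ : i ∈ Finset.univ) => hZle k t i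
    simp only [Finset.sum_const, Finset.card_univ, Fintype.card_fin, nsmul_eq_mul] at this
    linarith
  set B : Ω → ℝ := fun ω => 27 / (K : ℝ) ^ 2 * (30 * χ ^ 2 * L ^ 2 + 1 / (n : ℝ) *
    ∑ k ∈ Finset.range K, 1 / P.α k * (1 / (T : ℝ) * ∑ t ∈ Finset.range T, F k t ω)) with hB
  have hS1 : ∀ k, Integrable
      (fun ω => 1 / P.α k * (1 / (T : ℝ) * ∑ t ∈ Finset.range T, F k t ω)) μ := fun k =>
    ((integrable_finsetSum _ fun t _ => hFint k t).const_mul _).const_mul _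
  have hS2 := (integrable_finsetSum (Finset.range K) fun k _ => hS1 k).const_mul (1 / (n : ℝ))
  have hBint : Integrable B μ := ((integrable_const _).add hS2).const_mul _
  have hS1le : ∀ k, ∫ ω, 1 / P.α k * (1 / (T : ℝ) * ∑ t ∈ Finset.range T, F k t ω) ∂μ
      ≤ n * (3 * (4 * L ^ 2 + σ ^ 2) / T) := by
    intro k
    rw [integral_const_mul, integral_const_mul, integral_finsetSum _ fun t _ => hFint k t]
    have h1 := Finset.sum_le_sum fun t (_ : t ∈ Finset.range T) => hFle k t
    simp only [Finset.sum_const, Finset.card_range, nsmul_eq_mul] at h1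
    have hαk := hα k
    refine (mul_le_mul_of_nonneg_left (mul_le_mul_of_nonneg_left h1 (by positivity))
      (by positivity)).trans_eq ?_
    rw [hη]
    field_simp
  have hBle : ∫ ω, B ω ∂μ ≤
      810 * (χ ^ 2 * L ^ 2) / (K : ℝ) ^ 2 + 324 * (L + σ) ^ 2 / ((K : ℝ) * T) := by
    simp only [hB]
    rw [integral_const_mul, integral_add (integrable_const _) hS2, integral_const_mul (1 / (n : ℝ)),
      integral_finsetSum _ fun k _ => hS1 k]
    have h1 := Finset.sum_le_sum fun k (_ : k ∈ Finset.range K) => hS1le k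
    simp only [Finset.sum_const, Finset.card_range, nsmul_eq_mul] at h1
    -- The factor 1/α_k cancels the α_k in the inner step size, so every outer iteration contributes
    -- equally, and the sum over nodes cancels 1/n.
    have h2 : 1 / (n : ℝ) * (K * (n * (3 * (4 * L ^ 2 + σ ^ 2) / T)))
        ≤ K * (12 * (L + σ) ^ 2 / T) := by
      have e : 1 / (n : ℝ) * (K * (n * (3 * (4 * L ^ 2 + σ ^ 2) / T)))
        = K * (3 * (4 * L ^ 2 + σ ^ 2) / T) := by field_simp
      rw [e]
      refine mul_le_mul_of_nonneg_left (div_le_div_of_nonneg_right ?_ hT0.le) hK0.le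
      nlinarith [mul_nonneg hL0 hσ, sq_nonneg σ]
    have h3 := (mul_le_mul_of_nonneg_left h1 (by positivity : 0 ≤ 1 / (n : ℝ))).trans h2
    simp only [integral_const, probReal_univ, smul_eq_mul, one_mul]
    refine (mul_le_mul_of_nonneg_left (add_le_add le_rfl h3) (by positivity)).trans_eq ?_
    field_simp
    ring
  have hgap0 : ∀ ω, 0 ≤ gap ω := fun ω => le_trans (by positivity) (hp.quadratic_growth (xo ω))
  have hgapB : ∀ ω, gap ω ≤ B ω := by
    intro ω
    refine (gap_algOutput_le hp hn hK hT hW (sampleOracle gt sample ω)).trans ?_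
    refine mul_le_mul_of_nonneg_left (add_le_add le_rfl (mul_le_mul_of_nonneg_left
      (Finset.sum_le_sum fun k _ => mul_le_mul_of_nonneg_left ?_ ?_) ?_)) ?_
    · exact oracleError_le (hη0 k) xs _ _
    · exact (one_div_pos.2 (hα k)).le
    · positivity
    · positivity
  have hqm : ∀ i, Measurable (q i) := by
    intro i
    have : LipschitzWith ⟨L, hL0⟩ (q i) :=
      LipschitzWith.of_le_add_mul _ fun x y => by
        have := hp.lipschitz i y x
        rw [dist_eq_norm]
        change q i x ≤ q i y + L * ‖x - y‖
        linarith
    exact this.continuous.measurable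
  have hxo : Measurable xo := measurable_algOutput h hL hs hD hind P K T W
  have hgm : Measurable gap :=
    (((Finset.measurable_sum _ fun i _ => (hqm i).comp hxo).const_mul _).add
      ((hxo.norm.pow_const 2).const_mul _)).sub_const _
  -- Quadratic growth makes the gap nonnegative, so the integrable pathwise bound dominates it.
  have hgi : Integrable gap μ := hBint.mono' hgm.aestronglyMeasurable
    (Filter.Eventually.of_forall fun ω => by
      rw [Real.norm_of_nonneg (hgap0 ω)]
      exact hgapB ω)
  exact ⟨hgi, (integral_mono hgi hBint hgapB).trans hBle⟩

end Run

/-! ### Reduction of the asymmetric saddle-point problem -/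

section Rescaling

variable {n dξ dζ : ℕ}

/-- The change of variables `rescale` as a linear map. -/
noncomputable def rescaleLinear (dξ dζ : ℕ) (rξ rζ : ℝ) : SPSpace dξ dζ →ₗ[ℝ] SPSpace dξ dζ where
  toFun := rescale rξ rζ
  map_add' x y := by
    simp only [rescale, WithLp.add_fst, WithLp.add_snd, smul_add]
    rfl
  map_smul' c x := by
    simp only [rescale, WithLp.smul_fst, WithLp.smul_snd, smul_comm _ c]
    rfl

/-- The inverse of `rescale`. -/
noncomputable def unscale (rξ rζ : ℝ) (x : SPSpace dξ dζ) : SPSpace dξ dζ :=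
  WithLp.toLp 2 (Real.sqrt rξ • x.fst, Real.sqrt rζ • x.snd)

section

variable {rξ rζ : ℝ} (hξ : 0 < rξ) (hζ : 0 < rζ)
include hξ hζ

theorem rescale_unscale (x : SPSpace dξ dζ) : rescale rξ rζ (unscale rξ rζ x) = x := by
  have h1 := (Real.sqrt_pos.2 hξ).ne'
  have h2 := (Real.sqrt_pos.2 hζ).ne'
  have e1 : (rescale rξ rζ (unscale rξ rζ x)).fst = x.fst := inv_smul_smul₀ h1 _
  have e2 : (rescale rξ rζ (unscale rξ rζ x)).snd = x.snd := inv_smul_smul₀ h2 _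
  exact WithLp.ofLp_injective 2 (Prod.ext e1 e2)

/-- Cauchy–Schwarz. The sum of the two norms is what is needed, since `gapFun` varies at rate M in
each of its two arguments; so the Lipschitz constant has no extra factor. -/
theorem norm_rescale_fst_add_snd_le (x : SPSpace dξ dζ) :
    ‖(rescale rξ rζ x).fst‖ + ‖(rescale rξ rζ x).snd‖
      ≤ Real.sqrt (1 / rξ + 1 / rζ) * ‖x‖ := by
  have h1 : ‖(rescale rξ rζ x).fst‖ = (Real.sqrt rξ)⁻¹ * ‖x.fst‖ := by
    change ‖(Real.sqrt rξ)⁻¹ • x.fst‖ = _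
    rw [norm_smul, Real.norm_of_nonneg (by positivity)]
  have h2 : ‖(rescale rξ rζ x).snd‖ = (Real.sqrt rζ)⁻¹ * ‖x.snd‖ := by
    change ‖(Real.sqrt rζ)⁻¹ • x.snd‖ = _
    rw [norm_smul, Real.norm_of_nonneg (by positivity)]
  refine le_of_sq_le_sq ?_ (by positivity)
  rw [mul_pow, Real.sq_sqrt (by positivity), WithLp.prod_norm_sq_eq_of_L2, h1, h2]
  have e1 : (Real.sqrt rξ)⁻¹ ^ 2 = 1 / rξ := by rw [inv_pow, Real.sq_sqrt hξ.le, one_div]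
  have e2 : (Real.sqrt rζ)⁻¹ ^ 2 = 1 / rζ := by rw [inv_pow, Real.sq_sqrt hζ.le, one_div]
  rw [← e1, ← e2]
  nlinarith [sq_nonneg ((Real.sqrt rξ)⁻¹ * ‖x.snd‖ - (Real.sqrt rζ)⁻¹ * ‖x.fst‖)]

theorem norm_rescale_le (x : SPSpace dξ dζ) :
    ‖rescale rξ rζ x‖ ≤ Real.sqrt (1 / rξ + 1 / rζ) * ‖x‖ := by
  refine le_trans ?_ (norm_rescale_fst_add_snd_le hξ hζ x)
  refine le_of_sq_le_sq ?_ (by positivity)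
  rw [WithLp.prod_norm_sq_eq_of_L2]
  nlinarith [norm_nonneg (rescale rξ rζ x).fst, norm_nonneg (rescale rξ rζ x).snd]

omit hξ hζ in
theorem inner_rescale_left (x y : SPSpace dξ dζ) :
    inner ℝ (rescale rξ rζ x) y = inner ℝ x (rescale rξ rζ y) := by
  rw [WithLp.prod_inner_apply, WithLp.prod_inner_apply]
  change inner ℝ ((Real.sqrt rξ)⁻¹ • x.fst) y.fst + inner ℝ ((Real.sqrt rζ)⁻¹ • x.snd) y.snd
    = inner ℝ x.fst ((Real.sqrt rξ)⁻¹ • y.fst) + inner ℝ x.snd ((Real.sqrt rζ)⁻¹ • y.snd)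
  simp only [real_inner_smul_left, real_inner_smul_right]

/-- The rescaled functions `f i (ξ, ζ*) - f i (ξ*, ζ)`. -/
noncomputable def gapFun (f : Fin n → SPFun dξ dζ) (rξ rζ : ℝ) (xs : SPSpace dξ dζ) (i : Fin n)
    (x : SPSpace dξ dζ) : ℝ :=
  f i (rescale rξ rζ x).fst xs.snd - f i xs.fst (rescale rξ rζ x).snd

theorem gapSPP_rescale (f : Fin n → SPFun dξ dζ) (xs x : SPSpace dξ dζ) :
    gapSPP (asymObjective f rξ rζ) xs (rescale rξ rζ x)
      = 1 / (n : ℝ) * ∑ i, gapFun f rξ rζ xs i x + 1 / 2 * ‖x‖ ^ 2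
        - 1 / 2 * ‖unscale rξ rζ xs‖ ^ 2 := by
  have e1 : ‖(rescale rξ rζ x).fst‖ ^ 2 = 1 / rξ * ‖x.fst‖ ^ 2 := by
    change ‖(Real.sqrt rξ)⁻¹ • x.fst‖ ^ 2 = _
    rw [norm_smul, mul_pow, Real.norm_eq_abs, sq_abs, inv_pow, Real.sq_sqrt hξ.le, one_div]
  have e2 : ‖(rescale rξ rζ x).snd‖ ^ 2 = 1 / rζ * ‖x.snd‖ ^ 2 := by
    change ‖(Real.sqrt rζ)⁻¹ • x.snd‖ ^ 2 = _
    rw [norm_smul, mul_pow, Real.norm_eq_abs, sq_abs, inv_pow, Real.sq_sqrt hζ.le, one_div]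
  have e3 : ‖(unscale rξ rζ xs).fst‖ ^ 2 = rξ * ‖xs.fst‖ ^ 2 := by
    change ‖Real.sqrt rξ • xs.fst‖ ^ 2 = _
    rw [norm_smul, mul_pow, Real.norm_eq_abs, sq_abs, Real.sq_sqrt hξ.le]
  have e4 : ‖(unscale rξ rζ xs).snd‖ ^ 2 = rζ * ‖xs.snd‖ ^ 2 := by
    change ‖Real.sqrt rζ • xs.snd‖ ^ 2 = _
    rw [norm_smul, mul_pow, Real.norm_eq_abs, sq_abs, Real.sq_sqrt hζ.le]
  simp only [gapSPP, asymObjective, gapFun, Finset.sum_sub_distrib]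
  rw [WithLp.prod_norm_sq_eq_of_L2 x, WithLp.prod_norm_sq_eq_of_L2 (unscale rξ rζ xs),
    e1, e2, e3, e4]
  field_simp
  ring

/-- Adding the two inequalities that define the saddle operator, taken at ξ* and ζ*, gives
`le_inner`. For the Lipschitz bound the field is evaluated at points with one component frozen at
the saddle point, and the saddle inequality gives optimality. -/
theorem nodeProblem_gapFun (hn : 0 < n) {f : Fin n → SPFun dξ dζ} {M : ℝ}
    (hf : ∀ i, ConvexConcave (f i)) (hM : ∀ i x, ∀ g ∈ saddleOperator (f i) x, ‖g‖ ≤ M)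
    {xs : SPSpace dξ dζ} (hxs : IsSolution (asymObjective f rξ rζ) xs)
    {gm : Fin n → SPSpace dξ dζ → SPSpace dξ dζ} (hgm : ∀ i x, gm i x ∈ saddleOperator (f i) x) :
    NodeProblem (gapFun f rξ rζ xs) (fun i x => rescale rξ rζ (gm i (rescale rξ rζ x)))
      (unscale rξ rζ xs) (M * Real.sqrt (1 / rξ + 1 / rζ)) := by
  have hM0 : 0 ≤ M := (norm_nonneg _).trans (hM ⟨0, hn⟩ 0 _ (hgm _ _))
  have hfst : ∀ v : SPSpace dξ dζ, ‖v.fst‖ ≤ ‖v‖ := fun v => by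
    refine le_of_sq_le_sq ?_ (norm_nonneg v)
    rw [WithLp.prod_norm_sq_eq_of_L2]
    nlinarith [sq_nonneg ‖v.snd‖]
  have hsnd : ∀ v : SPSpace dξ dζ, ‖v.snd‖ ≤ ‖v‖ := fun v => by
    refine le_of_sq_le_sq ?_ (norm_nonneg v)
    rw [WithLp.prod_norm_sq_eq_of_L2]
    nlinarith [sq_nonneg ‖v.fst‖]
  have hsub : ∀ x y : SPSpace dξ dζ,
      rescale rξ rζ (x - y) = rescale rξ rζ x - rescale rξ rζ y :=
    (rescaleLinear dξ dζ rξ rζ).map_sub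
  refine ⟨fun i => ?_, fun i x x' => ?_, fun i => ?_, fun i x => ?_, fun i x => ?_, fun x => ?_⟩
  · have h1 := ((hf i).1 xs.snd).comp_linearMap
      ((WithLp.fstₗ 2 ℝ _ _).comp (rescaleLinear dξ dζ rξ rζ))
    have h2 := ((hf i).2 xs.fst).neg.comp_linearMap
      ((WithLp.sndₗ 2 ℝ _ _).comp (rescaleLinear dξ dζ rξ rζ))
    exact (h1.add h2).congr fun x _ => (sub_eq_add_neg _ _).symm
  · set X := rescale rξ rζ x with hX
    set X' := rescale rξ rζ x' with hX'
    have hξL : f i X'.fst xs.snd - f i X.fst xs.snd ≤ M * ‖(X' - X).fst‖ := by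
      set p : SPSpace dξ dζ := WithLp.toLp 2 (X'.fst, xs.snd)
      have h1 := (hgm i p).1 X.fst
      have h2 := real_inner_le_norm (gm i p).fst (X'.fst - X.fst)
      have h3 := (hfst _).trans (hM i p _ (hgm i p))
      have h4 : inner ℝ (gm i p).fst (X.fst - X'.fst)
          = -inner ℝ (gm i p).fst (X'.fst - X.fst) := by
        rw [← inner_neg_right, neg_sub]
      have h5 := mul_le_mul_of_nonneg_right h3 (norm_nonneg (X'.fst - X.fst))
      change f i X'.fst xs.snd + inner ℝ (gm i p).fst (X.fst - X'.fst) ≤ f i X.fst xs.snd at h1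
      change _ ≤ M * ‖X'.fst - X.fst‖
      linarith
    have hζL : f i xs.fst X.snd - f i xs.fst X'.snd ≤ M * ‖(X' - X).snd‖ := by
      set p : SPSpace dξ dζ := WithLp.toLp 2 (xs.fst, X'.snd)
      have h1 := (hgm i p).2 X.snd
      have h2 := real_inner_le_norm (gm i p).snd (X'.snd - X.snd)
      have h3 := (hsnd _).trans (hM i p _ (hgm i p))
      have h4 : inner ℝ (-(gm i p).snd) (X.snd - X'.snd)
          = inner ℝ (gm i p).snd (X'.snd - X.snd) := by
        rw [← inner_neg_neg, neg_neg, neg_sub]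
      have h5 := mul_le_mul_of_nonneg_right h3 (norm_nonneg (X'.snd - X.snd))
      change f i xs.fst X.snd ≤ f i xs.fst X'.snd + inner ℝ (-(gm i p).snd) (X.snd - X'.snd) at h1
      change _ ≤ M * ‖X'.snd - X.snd‖
      linarith
    have h6 := mul_le_mul_of_nonneg_left (norm_rescale_fst_add_snd_le hξ hζ (x' - x)) hM0
    rw [hsub] at h6
    change f i X'.fst xs.snd - f i xs.fst X'.snd - (f i X.fst xs.snd - f i xs.fst X.snd) ≤ _
    linarith
  · simp only [gapFun, rescale_unscale hξ hζ, sub_self]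
  · set X := rescale rξ rζ x with hX
    have h1 := (hgm i X).1 xs.fst
    have h2 := (hgm i X).2 xs.snd
    rw [inner_rescale_left, hsub, rescale_unscale hξ hζ, ← hX, WithLp.prod_inner_apply]
    change f i X.fst xs.snd - f i xs.fst X.snd
      ≤ inner ℝ (gm i X).fst (X.fst - xs.fst) + inner ℝ (gm i X).snd (X.snd - xs.snd)
    rw [← neg_sub X.fst, inner_neg_right] at h1
    rw [← neg_sub X.snd, inner_neg_neg] at h2
    linarith
  · refine (norm_rescale_le hξ hζ _).trans ?_
    rw [mul_comm]
    exact mul_le_mul_of_nonneg_right (hM i _ _ (hgm i _)) (Real.sqrt_nonneg _)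
  · have h1 := hxs (rescale rξ rζ x).fst (mem_univ _) (rescale rξ rζ x).snd (mem_univ _)
    have h2 := gapSPP_rescale hξ hζ f xs x
    have h3 : 0 ≤ gapSPP (asymObjective f rξ rζ) xs (rescale rξ rζ x) := sub_nonneg.2 h1
    linarith

theorem unbiasedOracle_rescale {S : Type*} [MeasurableSpace S] {D : Measure S}
    [IsProbabilityMeasure D] {T : Fin n → SPSpace dξ dζ → Set (SPSpace dξ dζ)} {σ : ℝ}
    {gt : Fin n → S → SPSpace dξ dζ → SPSpace dξ dζ} (h : IsStochasticOracle D T σ gt)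
    (i : Fin n) :
    UnbiasedOracle D (fun s x => rescale rξ rζ (gt i s (rescale rξ rζ x)))
      (fun x => rescale rξ rζ (∫ s, gt i s (rescale rξ rζ x) ∂D))
      (σ * Real.sqrt (1 / rξ + 1 / rζ)) := by
  let R : SPSpace dξ dζ →L[ℝ] SPSpace dξ dζ :=
    (rescaleLinear dξ dζ rξ rζ).mkContinuous (Real.sqrt (1 / rξ + 1 / rζ)) (norm_rescale_le hξ hζ)
  have hR : ∀ x, rescale rξ rζ x = R x := fun _ => rfl
  refine ⟨?_, fun x => ?_, fun x => ?_, fun x => ?_⟩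
  · simp only [hR]
    exact R.measurable.comp ((h.measurable i).comp
      (measurable_fst.prodMk (R.measurable.comp measurable_snd)))
  · exact R.comp_memLp' (h.memLp i (rescale rξ rζ x))
  · exact R.integral_comp_comm ((h.memLp i (rescale rξ rζ x)).integrable one_le_two)
  · set X := rescale rξ rζ x
    have hm : MemLp (fun s => gt i s X - ∫ s', gt i s' X ∂D) 2 D :=
      (h.memLp i X).sub (memLp_const _)
    have hb : ∀ v : SPSpace dξ dζ, ‖R v‖ ^ 2 ≤ (1 / rξ + 1 / rζ) * ‖v‖ ^ 2 := fun v => by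
      have := pow_le_pow_left₀ (norm_nonneg _) (norm_rescale_le hξ hζ v) 2
      rwa [mul_pow, Real.sq_sqrt (by positivity)] at this
    simp only [hR, ← map_sub]
    calc ∫ s, ‖R (gt i s X - ∫ s', gt i s' X ∂D)‖ ^ 2 ∂D
        ≤ ∫ s, (1 / rξ + 1 / rζ) * ‖gt i s X - ∫ s', gt i s' X ∂D‖ ^ 2 ∂D :=
          integral_mono ((R.comp_memLp' hm).integrable_norm_pow two_ne_zero)
            ((hm.integrable_norm_pow two_ne_zero).const_mul _) fun s => hb _
      _ ≤ (1 / rξ + 1 / rζ) * σ ^ 2 := by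
          rw [integral_const_mul]
          exact mul_le_mul_of_nonneg_left (h.variance_le i X) (by positivity)
      _ = (σ * Real.sqrt (1 / rξ + 1 / rζ)) ^ 2 := by
          rw [mul_pow, Real.sq_sqrt (by positivity), mul_comm]

end

/-- The expected gap at the output of the algorithm for the asymmetric problem. -/
theorem integral_gapSPP_asymOutput_le (hn : 0 < n) {f : Fin n → SPFun dξ dζ} {rξ rζ M : ℝ}
    (hξ : 0 < rξ) (hζ : 0 < rζ) (hf : ∀ i, ConvexConcave (f i))
    (hM : ∀ i x, ∀ g ∈ saddleOperator (f i) x, ‖g‖ ≤ M)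
    {xs : SPSpace dξ dζ} (hxs : IsSolution (asymObjective f rξ rζ) xs)
    {edges : ℝ≥0 → Set (Fin n × Fin n)} {W : ℝ≥0 → Matrix (Fin n) (Fin n) ℝ} {χ : ℝ}
    (hW : IsGossip edges W) (hχ : HasConditionNumber W χ) (time : ℕ → ℝ≥0)
    {S : Type*} [MeasurableSpace S] {D : Measure S} [IsProbabilityMeasure D]
    {σ : ℝ} (hσ : 0 ≤ σ) {gt : Fin n → S → SPSpace dξ dζ → SPSpace dξ dζ}
    (hgt : IsStochasticOracle D (fun i => saddleOperator (f i)) σ gt)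
    {Ω : Type*} [MeasurableSpace Ω] {μ : Measure Ω} [IsProbabilityMeasure μ]
    {sample : ℕ × ℕ → Ω → S} (hs : ∀ q, Measurable (sample q)) (hD : ∀ q, μ.map (sample q) = D)
    (hind : iIndepFun sample μ) {K T : ℕ} (hK : 1 ≤ K) (hT : 1 ≤ T) :
    let gap : Ω → ℝ := fun ω => gapSPP (asymObjective f rξ rζ) xs
      (asymOutput rξ rζ χ K T (fun k => W (time k)) (fun k t i x => gt i (sample (k, t) ω) x))
    Integrable gap μ ∧ ∫ ω, gap ω ∂μ ≤
      810 * (χ ^ 2 * (M ^ 2 * (1 / rξ + 1 / rζ))) / (K : ℝ) ^ 2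
        + 324 * ((M + σ) ^ 2 * (1 / rξ + 1 / rζ)) / ((K : ℝ) * T) := by
  intro gap
  have hp := nodeProblem_gapFun hξ hζ hn hf hM hxs hgt.mean_mem
  have h := integral_gap_algOutput_le hp hn hK hT (W := fun k => W (time k)) (χ := χ)
    (fun k => isGossipOperator_gossipMap hn (hW.mulVec_one _) (hW.transpose_mulVec_one _) hχ.1
      (hχ.2 _)) (unbiasedOracle_rescale hξ hζ hgt) (by positivity) hs hD hind
  have e : gap = fun ω => 1 / (n : ℝ) * ∑ i, gapFun f rξ rζ xs i
        (algOutput (stdParams 1 χ K T) K T 0 0 0 0 (fun k => W (time k))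
          (sampleOracle (fun i s x => rescale rξ rζ (gt i s (rescale rξ rζ x))) sample ω))
      + 1 / 2 * ‖algOutput (stdParams 1 χ K T) K T 0 0 0 0 (fun k => W (time k))
          (sampleOracle (fun i s x => rescale rξ rζ (gt i s (rescale rξ rζ x))) sample ω)‖ ^ 2
      - 1 / 2 * ‖unscale rξ rζ xs‖ ^ 2 := funext fun ω => gapSPP_rescale hξ hζ f xs _
  rw [e]
  refine ⟨h.1, h.2.trans_eq ?_⟩
  rw [← add_mul, mul_pow, mul_pow, Real.sq_sqrt (by positivity)]

end Rescaling

/-! ### Choice of the number of rounds and of inner steps -/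

theorem mainTheorem3 :
    ∃ C : ℝ, 0 < C ∧
    ∀ (n dξ dζ : ℕ) (_ : 0 < n)
      -- the problem
      (f : Fin n → SPFun dξ dζ) (rξ rζ M : ℝ) (_ : 0 < rξ) (_ : 0 < rζ)
      (_ : ∀ i, ConvexConcave (f i))
      (_ : ∀ i x, ∀ g ∈ saddleOperator (f i) x, ‖g‖ ≤ M)
      (xs : SPSpace dξ dζ) (_ : IsSolution (asymObjective f rξ rζ) xs)
      -- the network, and the times of the communication rounds
      (edges : ℝ≥0 → Set (Fin n × Fin n)) (W : ℝ≥0 → Matrix (Fin n) (Fin n) ℝ) (χ : ℝ)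
      (_ : IsGossip edges W) (_ : HasConditionNumber W χ) (time : ℕ → ℝ≥0)
      -- the oracle, and independent samples for its calls
      (S : Type*) [MeasurableSpace S] (D : Measure S) [IsProbabilityMeasure D]
      (σ : ℝ) (_ : 0 ≤ σ) (gt : Fin n → S → SPSpace dξ dζ → SPSpace dξ dζ)
      (_ : IsStochasticOracle D (fun i => saddleOperator (f i)) σ gt)
      (Ω : Type*) [MeasurableSpace Ω] (μ : Measure Ω) [IsProbabilityMeasure μ]
      (sample : ℕ × ℕ → Ω → S) (_ : ∀ q, Measurable (sample q))
      (_ : ∀ q, μ.map (sample q) = D) (_ : iIndepFun sample μ)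
      -- the accuracy
      (ε : ℝ) (_ : 0 < ε),
      let gap : ℕ → ℕ → Ω → ℝ := fun K T ω =>
        gapSPP (asymObjective f rξ rζ) xs
          (asymOutput rξ rζ χ K T (fun k => W (time k))
            (fun k t i x => gt i (sample (k, t) ω) x))
      let a : ℝ := χ * M / Real.sqrt ε * Real.sqrt (1 / rξ + 1 / rζ)
      let b : ℝ := (M + σ) ^ 2 / ε * (1 / rξ + 1 / rζ)
      -- `O(a)` communication rounds and `O(b)` oracle calls are enough
      (∀ K T : ℕ, 1 ≤ K → 1 ≤ T →
        C * a ≤ communicationRounds K → C * b ≤ oracleCalls K T →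
        Integrable (gap K T) μ ∧ ∫ ω, gap K T ω ∂μ ≤ ε) ∧
      -- a choice of `K` and `T` with these costs; every round has at least one oracle call
      (∃ K T : ℕ, 1 ≤ K ∧ 1 ≤ T ∧
        (communicationRounds K : ℝ) ≤ C * a + 1 ∧
        (oracleCalls K T : ℝ) ≤ C * max a b + 1 ∧
        (a ≤ b → (oracleCalls K T : ℝ) ≤ C * b + 1) ∧
        Integrable (gap K T) μ ∧ ∫ ω, gap K T ω ∂μ ≤ ε) := by
  -- A factor 400 suffices for the accuracy; it is doubled because KT is bounded by 400 (a + b) + 1,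
  -- and a + b ≤ 2 max(a, b).
  refine ⟨800, by norm_num, ?_⟩
  intro n dξ dζ hn f rξ rζ M hξ hζ hf hM xs hxs edges W χ hW hχ time S _ D _ σ hσ gt hgt Ω _ μ _
    sample hs hD hind ε hε gap a b
  have hM0 : 0 ≤ M := (norm_nonneg _).trans (hM ⟨0, hn⟩ 0 _ (hgt.mean_mem _ _))
  have hχ1 := hχ.1
  set c := 1 / rξ + 1 / rζ with hc
  have hc0 : 0 < c := by positivity
  have ha0 : 0 ≤ a := by
    have : 0 ≤ χ := by linarith
    positivity
  have hb0 : 0 ≤ b := by positivity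
  have ha2 : χ ^ 2 * (M ^ 2 * c) = ε * a ^ 2 := by
    have : a ^ 2 = (χ * M) ^ 2 / ε * c := by
      simp only [a]
      rw [mul_pow, div_pow, Real.sq_sqrt hε.le, Real.sq_sqrt hc0.le]
    rw [this]
    field_simp
  have hb2 : (M + σ) ^ 2 * c = ε * b := by
    have : b = (M + σ) ^ 2 / ε * c := rfl
    rw [this]
    field_simp
  have main : ∀ K T : ℕ, 1 ≤ K → 1 ≤ T → 400 * a ≤ K → 400 * b ≤ (K : ℝ) * T →
      Integrable (gap K T) μ ∧ ∫ ω, gap K T ω ∂μ ≤ ε := by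
    intro K T hK hT hKa hKb
    have h := integral_gapSPP_asymOutput_le hn hξ hζ hf hM hxs hW hχ time hσ hgt hs hD hind hK hT
    refine ⟨h.1, h.2.trans ?_⟩
    have hK0 : (0 : ℝ) < K := by exact_mod_cast hK
    have hT0 : (0 : ℝ) < T := by exact_mod_cast hT
    rw [← hc, ha2, hb2]
    -- The accuracy is split as 1/10 + 9/10, since K enters squared here and KT only linearly in the
    -- second term: 810/400² ≤ 1/10 and 324/400 ≤ 9/10.
    have h1 : 810 * (ε * a ^ 2) / (K : ℝ) ^ 2 ≤ ε * (1 / 10) := by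
      rw [div_le_iff₀ (by positivity)]
      have : (400 * a) ^ 2 ≤ (K : ℝ) ^ 2 := pow_le_pow_left₀ (by positivity) hKa 2
      have := mul_le_mul_of_nonneg_left this hε.le
      have : 0 ≤ ε * a ^ 2 := by positivity
      linarith
    have h2 : 324 * (ε * b) / ((K : ℝ) * T) ≤ ε * (9 / 10) := by
      rw [div_le_iff₀ (by positivity)]
      have := mul_le_mul_of_nonneg_left hKb hε.le
      have : 0 ≤ ε * b := by positivity
      linarith
    linarith
  refine ⟨fun K T hK hT hKa hKb => main K T hK hT ?_ ?_, ?_⟩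
  · simp only [communicationRounds] at hKa
    linarith
  · simp only [oracleCalls] at hKb
    push_cast at hKb
    linarith
  · set K := max 1 ⌈400 * a⌉₊ with hKdef
    set T := max 1 ⌈400 * b / K⌉₊ with hTdef
    have hK : 1 ≤ K := le_max_left _ _
    have hT : 1 ≤ T := le_max_left _ _
    have hK0 : (0 : ℝ) < K := by exact_mod_cast hK
    have hKa : 400 * a ≤ K := (Nat.le_ceil _).trans (by exact_mod_cast le_max_right _ _)
    have hKle : (K : ℝ) ≤ 400 * a + 1 := by
      rw [hKdef, Nat.cast_max]
      refine max_le (by push_cast; linarith) (Nat.ceil_lt_add_one (by positivity)).le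
    have hTb : 400 * b ≤ (K : ℝ) * T := by
      have : 400 * b / K ≤ (T : ℝ) := (Nat.le_ceil _).trans (by exact_mod_cast le_max_right _ _)
      rw [div_le_iff₀ hK0] at this
      linarith
    have hTle : (T : ℝ) ≤ 400 * b / K + 1 := by
      have : 0 ≤ 400 * b / K := by positivity
      rw [hTdef, Nat.cast_max]
      exact max_le (by push_cast; linarith) (Nat.ceil_lt_add_one this).le
    -- Rounding T up costs at most K further calls, which is where a enters the oracle complexity.
    have hKT : (K : ℝ) * T ≤ 400 * a + 400 * b + 1 := by
      have := mul_le_mul_of_nonneg_left hTle hK0.le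
      rw [mul_add, mul_div_cancel₀ _ hK0.ne'] at this
      linarith
    refine ⟨K, T, hK, hT, ?_, ?_, fun hab => ?_, main K T hK hT hKa hTb⟩
    · simp only [communicationRounds]
      linarith
    · simp only [oracleCalls]
      push_cast
      have := le_max_left a b
      have := le_max_right a b
      linarith
    · simp only [oracleCalls]
      push_cast
      linarith
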